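/- Let $G$ be a group with unit $e$ and let $A$ be a C$^*$-algebra (not necessarily unital). Let $\alpha=(\{D_g\}_{g\in G},\{\alpha_g\}_{g\in G})$ be a partial action of $G$ on $A$: every $D_g$ is a closed two-sided ideal of $A$, every $\alpha_g:D_{g^{-1}}\to D_g$ is a $*$-isomorphism, $D_e=A$, $\alpha_g(D_{g^{-1}}\cap D_h)=D_g\cap D_{gh}$, and $\alpha_g(\alpha_h(x))=\alpha_{gh}(x)$ for all $g,h\in G$ and $x\in D_{h^{-1}}\cap D_{h^{-1}g^{-1}}$. Let $S(G)$ be the universal semigroup generated by symbols $[g]$, $g\in G$, with the relations $[g^{-1}][g][h]=[g^{-1}][gh]$, $[g][h][h^{-1}]=[gh][h^{-1}]$ and $[g][e]=[g]$. It is an inverse semigroup with unit $[e]$, with inverse operation $s\mapsto s^*$ satisfying $[g]^*=[g^{-1}]$. Its natural order is: $s\le t$ if and only if $s=tf$ for some idempotent $f$. Let $\beta=(\{E_s\},\{\beta_s\})_{s\in S(G)}$ be the (unique) action of $S(G)$ on $A$ corresponding to $\alpha$. That is, the $E_s$ are closed two-sided ideals of $A$, the $\beta_s:E_{s^*}\to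 E_s$ are $*$-isomorphisms with $\beta_r\circ\beta_s=\beta_{rs}$ as partially defined maps, $E_{[e]}=A$, and $E_{[g]}=D_g$ and $\beta_{[g]}=\alpha_g$ for all $g\in G$. Let $A\rtimes^a_\alpha G$ be the $*$-algebra of finite formal sums $\sum_g a_g\delta_g$ with $a_g\in D_g$, with $(a\delta_g)(b\delta_h)=\alpha_g(\alpha_{g^{-1}}(a)b)\delta_{gh}$ and $(a\delta_g)^*=\alpha_{g^{-1}}(a^*)\delta_{g^{-1}}$. Let $L$ be the $*$-algebra of finite formal sums $\sum_{s\in S(G)}a_s\delta_s$ with $a_s\in E_s$ and the analogous operations $(a\delta_r)(b\delta_s)=\beta_r(\beta_{r^*}(a)b)\delta_{rs}$ and $(a\delta_s)^*=\beta_{s^*}(a^*)\delta_{s^*}$. Let $N$ be the two-sided ideal of $L$ generated by the elements $a\delta_r-a\delta_t$ with $r\le t$ and $a\in E_r$, and put $A\rtimes^a_\beta S(G)=L/N$. The enveloping C$^*$-algebra of a $*$-algebra $B$ whose representations (the $*$-homomorphisms $\rho$ from $B$ to the bounded operators on a complex Hilbert space) satisfy $\rho_s(x):=\sup_\rho\|\rho(x)\|<\infty$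 for all $x\in B$ is the completion of $B/\ker\rho_s$ with respect to $\rho_s$. Both algebras above satisfy this condition. Let $A\rtimes_\alpha G$ and $A\rtimes_\beta S(G)$ be the enveloping C$^*$-algebras of $A\rtimes^a_\alpha G$ and $A\rtimes^a_\beta S(G)$. Then there is a $*$-isomorphism $A\rtimes_\alpha G\to A\rtimes_\beta S(G)$ which, for all $g\in G$ and $a\in D_g$, sends the class of $a\delta_g$ to the class of $a\delta_{[g]}$. -/

import Mathlib

namespace PCP

open Filter Topology

universe u v w

set_option linter.unusedSectionVars false

section Ideals

/-- A closed two-sided ideal of a (not necessarily unital) C*-algebra. -/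
structure ClosedIdeal (A : Type u) [NonUnitalCStarAlgebra A] extends Submodule ℂ A where
  mul_mem_left' : ∀ (a : A) {x : A}, x ∈ carrier → a * x ∈ carrier
  mul_mem_right' : ∀ {x : A} (a : A), x ∈ carrier → x * a ∈ carrier
  isClosed' : IsClosed carrier

namespace ClosedIdeal

variable {A : Type u} [NonUnitalCStarAlgebra A]

instance : SetLike (ClosedIdeal A) A where
  coe I := I.carrier
  coe_injective {I J} h := by
    cases I; cases J; congr; exact SetLike.coe_injective h

instance : NonUnitalSubringClass (ClosedIdeal A) A where
  add_mem {I} := I.toSubmodule.add_mem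
  zero_mem I := I.toSubmodule.zero_mem
  neg_mem {I} := I.toSubmodule.neg_mem
  mul_mem {I} a _ _ hb := I.mul_mem_left' a hb

instance : SMulMemClass (ClosedIdeal A) ℂ A where
  smul_mem {I} c _ h := I.toSubmodule.smul_mem c h

theorem mul_mem_left (I : ClosedIdeal A) (a : A) {x : A} (h : x ∈ I) : a * x ∈ I :=
  I.mul_mem_left' a h

theorem mul_mem_right (I : ClosedIdeal A) {x : A} (a : A) (h : x ∈ I) : x * a ∈ I :=
  I.mul_mem_right' a h

theorem isClosed (I : ClosedIdeal A) : IsClosed (I : Set A) := I.isClosed'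

/-- The self-adjoint part `I ∩ I*` of a closed ideal, as a C*-subalgebra. -/
def starPart (I : ClosedIdeal A) : NonUnitalStarSubalgebra ℂ A where
  carrier := {x | x ∈ I ∧ star x ∈ I}
  add_mem' h k := ⟨add_mem h.1 k.1, by rw [star_add]; exact add_mem h.2 k.2⟩
  zero_mem' := ⟨zero_mem I, by rw [star_zero]; exact zero_mem I⟩
  mul_mem' h k := ⟨mul_mem h.1 k.1, by rw [star_mul]; exact mul_mem k.2 h.2⟩
  smul_mem' c _ h := ⟨SMulMemClass.smul_mem c h.1,
    by rw [star_smul]; exact SMulMemClass.smul_mem _ h.2⟩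
  star_mem' h := ⟨h.2, by rw [star_star]; exact h.1⟩

theorem isClosed_starPart (I : ClosedIdeal A) : IsClosed (I.starPart : Set A) :=
  I.isClosed.inter (I.isClosed.preimage continuous_star)

/-- A closed ideal of a C*-algebra has a right approximate unit. -/
theorem exists_approx (I : ClosedIdeal A) :
    ∃ (l : Filter A), l.NeBot ∧ (∀ᶠ e in l, e ∈ I ∧ star e ∈ I) ∧
      ∀ x ∈ I, Tendsto (fun e => x * e) l (𝓝 x) := by
  have : IsClosed (I.starPart : Set A) := I.isClosed_starPart
  let _ := CStarAlgebra.spectralOrder I.starPart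
  have _ := CStarAlgebra.spectralOrderedRing I.starPart
  have hu := CStarAlgebra.increasingApproximateUnit I.starPart
  set l := CStarAlgebra.approximateUnit I.starPart
  have := hu.neBot
  refine ⟨l.map Subtype.val, inferInstance, ?_, ?_⟩
  · simp only [eventually_map]
    exact Eventually.of_forall fun e => e.2
  · intro x hx
    rw [tendsto_map'_iff]
    have hxx : star x * x ∈ I.starPart :=
      ⟨I.mul_mem_left _ hx, by rw [star_mul, star_star]; exact I.mul_mem_left _ hx⟩
    have h1 : Tendsto (fun e : I.starPart => star x * x * (e : A)) l (𝓝 (star x * x)) :=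
      (continuous_subtype_val.tendsto _).comp (hu.tendsto_mul_left ⟨_, hxx⟩)
    have h2 : Tendsto (fun e : I.starPart => 2 * ‖star x * x - star x * x * (e : A)‖) l (𝓝 0) := by
      have := (tendsto_const_nhds (x := star x * x)).sub h1
      simpa using this.norm.const_mul 2
    rw [tendsto_iff_norm_sub_tendsto_zero]
    have h3 : Tendsto (fun e : I.starPart => ‖x * (e : A) - x‖ ^ 2) l (𝓝 0) := by
      refine squeeze_zero' (Eventually.of_forall fun _ => by positivity) ?_ h2
      filter_upwards [hu.eventually_norm, hu.eventually_isSelfAdjoint] with e he hs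
      have hse : star (e : A) = e := congrArg Subtype.val hs.star_eq
      have : star (x * (e : A) - x) * (x * (e : A) - x)
          = (star x * x - star x * x * (e : A)) - e * (star x * x - star x * x * (e : A)) := by
        rw [star_sub, star_mul, hse]; noncomm_ring
      rw [sq, ← CStarRing.norm_star_mul_self, this]
      refine (norm_sub_le _ _).trans ?_
      have he' : ‖(e : A)‖ ≤ 1 := he
      have := norm_mul_le (e : A) (star x * x - star x * x * (e : A))
      nlinarith [norm_nonneg (star x * x - star x * x * (e : A))]
    have := h3.sqrt
    simpa [Real.sqrt_sq] using this

/-- Closed ideals of C*-algebras are self-adjoint. -/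
theorem star_mem' (I : ClosedIdeal A) {x : A} (hx : x ∈ I) : star x ∈ I := by
  obtain ⟨l, hl, he, ht⟩ := I.exists_approx
  refine I.isClosed.mem_of_tendsto ((continuous_star.tendsto _).comp (ht x hx)) ?_
  filter_upwards [he] with e he
  simp only [Function.comp, star_mul]
  exact I.mul_mem_right _ he.2

instance : StarMemClass (ClosedIdeal A) A where
  star_mem {I} _ h := I.star_mem' h

instance (I : ClosedIdeal A) : IsClosed (I : Set A) := I.isClosed

end ClosedIdeal

end Ideals

section Inverse

/-- An inverse semigroup with unit; the inverse `s*` of `s` is written `s⁻¹`. -/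
class InverseMonoid (S : Type v) extends Monoid S, Inv S where
  mul_inv_mul : ∀ s : S, s * s⁻¹ * s = s
  inv_mul_inv : ∀ s : S, s⁻¹ * s * s⁻¹ = s⁻¹
  inv_unique : ∀ s t : S, s * t * s = s → t * s * t = t → t = s⁻¹

namespace InverseMonoid

variable {S : Type v} [InverseMonoid S]

/-- The natural partial order of an inverse semigroup. -/
def NatLE (s t : S) : Prop := ∃ f : S, f * f = f ∧ s = t * f

instance : InvolutiveInv S where
  inv_inv s := (inv_unique s⁻¹ s (inv_mul_inv s) (mul_inv_mul s)).symm

theorem inv_of_idem {e : S} (he : e * e = e) : e⁻¹ = e :=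
  (inv_unique e e (by rw [he, he]) (by rw [he, he])).symm

theorem idem_mul {e f : S} (he : e * e = e) (hf : f * f = f) : (e * f) * (e * f) = e * f := by
  set x := (e * f)⁻¹ with hx
  have h1 : e * f * x * (e * f) = e * f := mul_inv_mul (e * f)
  have h2 : x * (e * f) * x = x := inv_mul_inv (e * f)
  have h3 : f * x * e = x := by
    apply inv_unique
    · calc e * f * (f * x * e) * (e * f) = e * (f * f) * x * (e * e) * f := by simp only [mul_assoc]
        _ = e * f := by rw [he, hf]; simpa only [mul_assoc] using h1
    · calc f * x * e * (e * f) * (f * x * e) = f * (x * ((e * e) * (f * f)) * x) * e := by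
            simp only [mul_assoc]
        _ = f * x * e := by rw [he, hf, h2]
  have h4 : x * x = x := by
    calc x * x = (f * x * e) * (f * x * e) := by rw [h3]
      _ = f * (x * (e * f) * x) * e := by simp only [mul_assoc]
      _ = x := by rw [h2, h3]
  have h5 : e * f = x := by
    have := inv_of_idem h4
    rw [hx, inv_inv] at this
    exact this
  rw [h5, h4]

theorem idem_comm {e f : S} (he : e * e = e) (hf : f * f = f) : e * f = f * e := by
  have h1 := idem_mul he hf
  have h2 := idem_mul hf he
  have : f * e = (e * f)⁻¹ := by
    apply inv_unique
    · calc e * f * (f * e) * (e * f) = e * (f * f) * (e * e) * f := by simp only [mul_assoc]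
        _ = e * f := by rw [he, hf]; simpa only [mul_assoc] using h1
    · calc f * e * (e * f) * (f * e) = f * (e * e) * (f * f) * e := by simp only [mul_assoc]
        _ = f * e := by rw [he, hf]; simpa only [mul_assoc] using h2
  rw [this, inv_of_idem h1]

theorem idem_mul_inv (s : S) : (s * s⁻¹) * (s * s⁻¹) = s * s⁻¹ := by
  rw [← mul_assoc, mul_inv_mul]

theorem idem_inv_mul (s : S) : (s⁻¹ * s) * (s⁻¹ * s) = s⁻¹ * s := by
  rw [← mul_assoc, inv_mul_inv]

theorem mul_inv_rev (s t : S) : (s * t)⁻¹ = t⁻¹ * s⁻¹ := by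
  have hc := idem_comm (idem_mul_inv t) (idem_inv_mul s)
  symm
  apply inv_unique
  · calc s * t * (t⁻¹ * s⁻¹) * (s * t) = s * ((t * t⁻¹) * (s⁻¹ * s)) * t := by simp only [mul_assoc]
      _ = (s * s⁻¹ * s) * (t * t⁻¹ * t) := by rw [hc]; simp only [mul_assoc]
      _ = s * t := by rw [mul_inv_mul, mul_inv_mul]
  · calc t⁻¹ * s⁻¹ * (s * t) * (t⁻¹ * s⁻¹) = t⁻¹ * ((s⁻¹ * s) * (t * t⁻¹)) * s⁻¹ := by
          simp only [mul_assoc]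
      _ = (t⁻¹ * t * t⁻¹) * (s⁻¹ * s * s⁻¹) := by rw [← hc]; simp only [mul_assoc]
      _ = t⁻¹ * s⁻¹ := by rw [inv_mul_inv, inv_mul_inv]

theorem one_inv : (1 : S)⁻¹ = 1 := inv_of_idem (mul_one 1)

/-- Passing to inverses preserves the natural order. -/
theorem NatLE.inv {s t : S} (h : NatLE s t) : NatLE s⁻¹ t⁻¹ := by
  obtain ⟨f, hf, rfl⟩ := h
  refine ⟨t * f * t⁻¹, ?_, ?_⟩
  · calc t * f * t⁻¹ * (t * f * t⁻¹) = t * (f * (t⁻¹ * t)) * f * t⁻¹ := by simp only [mul_assoc]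
      _ = t * ((t⁻¹ * t) * f) * f * t⁻¹ := by rw [idem_comm hf (idem_inv_mul t)]
      _ = (t * t⁻¹ * t) * (f * f) * t⁻¹ := by simp only [mul_assoc]
      _ = _ := by rw [mul_inv_mul, hf]
  · rw [mul_inv_rev, inv_of_idem hf]
    calc f * t⁻¹ = f * (t⁻¹ * t * t⁻¹) := by rw [inv_mul_inv]
      _ = (f * (t⁻¹ * t)) * t⁻¹ := by simp only [mul_assoc]
      _ = ((t⁻¹ * t) * f) * t⁻¹ := by rw [idem_comm hf (idem_inv_mul t)]
      _ = t⁻¹ * (t * f * t⁻¹) := by simp only [mul_assoc]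

end InverseMonoid

end Inverse

section Exel

/-- The defining relations of Exel's semigroup of a group `G`. -/
inductive ExelRel (G : Type v) [Group G] : FreeSemigroup G → FreeSemigroup G → Prop
  | inv_mul (g h : G) : ExelRel G
      (FreeSemigroup.of g⁻¹ * FreeSemigroup.of g * FreeSemigroup.of h)
      (FreeSemigroup.of g⁻¹ * FreeSemigroup.of (g * h))
  | mul_inv (g h : G) : ExelRel G
      (FreeSemigroup.of g * FreeSemigroup.of h * FreeSemigroup.of h⁻¹)
      (FreeSemigroup.of (g * h) * FreeSemigroup.of h⁻¹)
  | mul_one (g : G) : ExelRel G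
      (FreeSemigroup.of g * FreeSemigroup.of 1) (FreeSemigroup.of g)

/-- Exel's semigroup `S(G)`: the universal semigroup generated by symbols `[g]`, `g ∈ G`, subject
to `[g⁻¹][g][h] = [g⁻¹][gh]`, `[g][h][h⁻¹] = [gh][h⁻¹]` and `[g][e] = [g]`. -/
def ExelSemigroup (G : Type v) [Group G] : Type v := (conGen (ExelRel G)).Quotient

namespace ExelSemigroup

variable {G : Type v} [Group G]

instance : Semigroup (ExelSemigroup G) :=
  inferInstanceAs (Semigroup (conGen (ExelRel G)).Quotient)

/-- The generator `[g]` of `S(G)`. -/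
def gen (g : G) : ExelSemigroup G := ((FreeSemigroup.of g : FreeSemigroup G) : (conGen (ExelRel G)).Quotient)

theorem rel_inv_mul (g h : G) : gen g⁻¹ * gen g * gen h = gen g⁻¹ * gen (g * h) :=
  (Con.eq _).2 (ConGen.Rel.of _ _ (ExelRel.inv_mul g h))

theorem rel_mul_inv (g h : G) : gen g * gen h * gen h⁻¹ = gen (g * h) * gen h⁻¹ :=
  (Con.eq _).2 (ConGen.Rel.of _ _ (ExelRel.mul_inv g h))

theorem gen_mul_one (g : G) : gen g * gen 1 = gen g :=
  (Con.eq _).2 (ConGen.Rel.of _ _ (ExelRel.mul_one g))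

theorem rel_inv_mul' (g h : G) : gen g * gen g⁻¹ * gen h = gen g * gen (g⁻¹ * h) := by
  simpa using rel_inv_mul g⁻¹ h

theorem rel_mul_inv' (g h : G) : gen g * gen h⁻¹ * gen h = gen (g * h⁻¹) * gen h := by
  simpa using rel_mul_inv g h⁻¹

theorem one_mul_gen (g : G) : gen 1 * gen g = gen g := by
  have h1 := rel_mul_inv' g g
  have h2 := rel_inv_mul' g g
  simp only [mul_inv_cancel, inv_mul_cancel, gen_mul_one] at h1 h2
  rw [← h1, h2]

/-- The universal property of `S(G)`. -/
def lift {M : Type w} [Semigroup M] (f : G → M)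
    (h1 : ∀ g h, f g⁻¹ * f g * f h = f g⁻¹ * f (g * h))
    (h2 : ∀ g h, f g * f h * f h⁻¹ = f (g * h) * f h⁻¹)
    (h3 : ∀ g, f g * f 1 = f g) : ExelSemigroup G →ₙ* M where
  toFun := Quotient.lift (FreeSemigroup.lift f : FreeSemigroup G →ₙ* M) (by
    have : conGen (ExelRel G) ≤ Con.ker (FreeSemigroup.lift f : FreeSemigroup G →ₙ* M) := by
      rw [Con.conGen_le]
      rintro x y (⟨g, h⟩ | ⟨g, h⟩ | ⟨g⟩)
      · simpa [Con.ker_rel] using h1 g h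
      · simpa [Con.ker_rel] using h2 g h
      · simpa [Con.ker_rel] using h3 g
    exact fun x y h => this h)
  map_mul' x y := by
    induction x using Quotient.ind
    induction y using Quotient.ind
    exact map_mul (FreeSemigroup.lift f : FreeSemigroup G →ₙ* M) _ _

@[simp]
theorem lift_gen {M : Type w} [Semigroup M] (f : G → M) (h1) (h2) (h3) (g : G) :
    lift f h1 h2 h3 (gen g) = f g := FreeSemigroup.lift_of f g

theorem induction {p : ExelSemigroup G → Prop} (h0 : ∀ g, p (gen g))
    (h1 : ∀ g s, p s → p (gen g * s)) (s : ExelSemigroup G) : p s := by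
  induction s using Quotient.ind with
  | _ x =>
  induction x using FreeSemigroup.recOnMul with
  | ih1 g => exact h0 g
  | ih2 g x _ h => exact h1 g _ h

instance : Monoid (ExelSemigroup G) where
  one := gen 1
  one_mul s := by
    change gen 1 * s = s
    induction s using induction with
    | h0 g => exact one_mul_gen g
    | h1 g s _ => rw [← mul_assoc, one_mul_gen]
  mul_one s := by
    change s * gen 1 = s
    induction s using induction with
    | h0 g => exact gen_mul_one g
    | h1 g s h => rw [mul_assoc, h]

theorem one_def : (1 : ExelSemigroup G) = gen 1 := rfl

/-- The anti-homomorphism `*` of `S(G)` with `[g]* = [g⁻¹]`, as a map to the opposite semigroup. -/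
def starHom : ExelSemigroup G →ₙ* (ExelSemigroup G)ᵐᵒᵖ :=
  lift (fun g : G => MulOpposite.op (gen g⁻¹))
    (fun g h => by
      apply MulOpposite.unop_injective
      simpa [mul_assoc] using rel_mul_inv h⁻¹ g⁻¹)
    (fun g h => by
      apply MulOpposite.unop_injective
      simpa [mul_assoc] using rel_inv_mul h⁻¹ g⁻¹)
    (fun g => by
      apply MulOpposite.unop_injective
      simp [one_mul_gen])

instance : Inv (ExelSemigroup G) where
  inv s := (starHom s).unop

theorem gen_inv (g : G) : (gen g)⁻¹ = gen g⁻¹ := by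
  change (starHom (gen g)).unop = _
  simp [starHom]

theorem mul_inv_rev' (s t : ExelSemigroup G) : (s * t)⁻¹ = t⁻¹ * s⁻¹ := by
  change (starHom (s * t)).unop = _
  rw [map_mul]; rfl

theorem inv_inv' (s : ExelSemigroup G) : s⁻¹⁻¹ = s := by
  induction s using induction with
  | h0 g => simp [gen_inv]
  | h1 g s h => rw [mul_inv_rev', mul_inv_rev', h, gen_inv, gen_inv, inv_inv]

/-- The semigroup homomorphism `S(G) → G` with `[g] ↦ g`. -/
def degreeHom : ExelSemigroup G →ₙ* G :=
  lift (fun g : G => g) (by simp) (by simp) (by simp)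

/-- The homomorphism `γ : S(G) → G` with `γ [g] = g`. -/
def degree : ExelSemigroup G →* G where
  toFun := degreeHom
  map_one' := lift_gen _ _ _ _ _
  map_mul' := map_mul degreeHom

@[simp]
theorem degree_gen (g : G) : degree (gen g) = g :=
  lift_gen (fun g : G => g) (by simp) (by simp) (by simp) g

/-- The idempotent `ε_g = [g][g⁻¹]`. -/
def eps (g : G) : ExelSemigroup G := gen g * gen g⁻¹

theorem gen_mul_eps (h g : G) : gen h * eps g = eps (h * g) * gen h := by
  unfold eps
  rw [rel_inv_mul', ← mul_assoc, rel_mul_inv]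
  simp

theorem eps_mul_gen (h g : G) : eps g * gen h = gen h * eps (h⁻¹ * g) := by
  rw [gen_mul_eps]; simp

theorem gen_mul_gen (g h : G) : gen g * gen h = eps g * gen (g * h) := by
  unfold eps; rw [rel_inv_mul']; simp

theorem eps_mul_self (g : G) : eps g * eps g = eps g := by
  have := rel_inv_mul' g g
  simp only [inv_mul_cancel, gen_mul_one] at this
  unfold eps; rw [← mul_assoc, this]

theorem eps_mul_gen_self (g : G) : eps g * gen g = gen g := by
  have := rel_inv_mul' g g
  simpa only [inv_mul_cancel, gen_mul_one, eps] using this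

theorem eps_comm (g h : G) : eps g * eps h = eps h * eps g := by
  conv_lhs => rw [eps, mul_assoc, gen_mul_eps, ← mul_assoc, gen_mul_eps, mul_assoc]
  simp [eps]

/-- The products of the elements `ε_g`. -/
def epsProd : Submonoid (ExelSemigroup G) := Submonoid.closure (Set.range eps)

theorem epsProd_comm {x y : ExelSemigroup G} (hx : x ∈ epsProd) (hy : y ∈ epsProd) :
    x * y = y * x := by
  have h := Submonoid.closure_le_centralizer_centralizer (Set.range (eps (G := G))) hx
  rw [Submonoid.mem_centralizer_iff] at h
  refine (h y ?_).symm
  rw [← SetLike.mem_coe] at hy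
  refine (show epsProd ≤ Submonoid.centralizer (Set.range (eps (G := G))) from ?_) hy
  unfold epsProd
  rw [Submonoid.closure_le]
  rintro _ ⟨g, rfl⟩
  rw [SetLike.mem_coe, Submonoid.mem_centralizer_iff]
  rintro _ ⟨k, rfl⟩
  exact eps_comm k g

theorem epsProd_idem {x : ExelSemigroup G} (hx : x ∈ epsProd) : x * x = x ∧ x⁻¹ = x := by
  induction hx using Submonoid.closure_induction with
  | mem x h =>
    obtain ⟨g, rfl⟩ := h
    exact ⟨eps_mul_self g, by simp [eps, mul_inv_rev', gen_inv]⟩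
  | one => exact ⟨mul_one 1, by simp [one_def, gen_inv]⟩
  | mul x y hx hy h k =>
    have hc := epsProd_comm hx hy
    refine ⟨?_, by rw [mul_inv_rev', h.2, k.2, hc]⟩
    calc x * y * (x * y) = x * (y * x) * y := by simp only [mul_assoc]
      _ = (x * x) * (y * y) := by rw [← hc]; simp only [mul_assoc]
      _ = x * y := by rw [h.1, k.1]

/-- The standard form of an element of `S(G)`. -/
theorem exists_standard_form (s : ExelSemigroup G) : ∃ x ∈ epsProd, s = x * gen (degree s) := by
  induction s using induction with
  | h0 g => exact ⟨1, one_mem _, by simp⟩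
  | h1 g s h =>
    obtain ⟨x, hx, hs⟩ := h
    have key : ∃ y ∈ epsProd, gen g * x = y * gen g := by
      clear hs
      induction hx using Submonoid.closure_induction with
      | mem x h =>
        obtain ⟨k, rfl⟩ := h
        exact ⟨_, Submonoid.subset_closure ⟨g * k, rfl⟩, gen_mul_eps g k⟩
      | one => exact ⟨1, one_mem _, by simp⟩
      | mul x y hx hy h k =>
        obtain ⟨x', hx', ex⟩ := h
        obtain ⟨y', hy', ey⟩ := k
        exact ⟨x' * y', mul_mem hx' hy', by rw [← mul_assoc, ex, mul_assoc, ey, mul_assoc]⟩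
    obtain ⟨y, hy, e⟩ := key
    refine ⟨y * eps g, mul_mem hy (Submonoid.subset_closure ⟨g, rfl⟩), ?_⟩
    conv_lhs => rw [hs, ← mul_assoc, e, mul_assoc, gen_mul_gen]
    simp [mul_assoc]

theorem mem_epsProd_of_idem {s : ExelSemigroup G} (h : s * s = s) : s ∈ epsProd := by
  obtain ⟨x, hx, hs⟩ := exists_standard_form s
  have hd : degree s = 1 := by
    have := congrArg degree h
    rwa [map_mul, mul_eq_left] at this
  rw [hd, ← one_def, mul_one] at hs
  rwa [hs]

theorem mul_inv_mul' (s : ExelSemigroup G) : s * s⁻¹ * s = s := by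
  obtain ⟨x, hx, hs⟩ := exists_standard_form s
  set g := degree s
  have he : eps g ∈ epsProd := Submonoid.subset_closure ⟨g, rfl⟩
  rw [hs, mul_inv_rev', gen_inv, (epsProd_idem hx).2]
  calc x * gen g * (gen g⁻¹ * x) * (x * gen g) = x * (eps g * (x * x)) * gen g := by
        simp only [mul_assoc, eps]
    _ = x * (x * x * eps g) * gen g := by rw [epsProd_comm he (mul_mem hx hx)]
    _ = x * x * (x * (eps g * gen g)) := by simp only [mul_assoc]
    _ = x * gen g := by rw [eps_mul_gen_self, (epsProd_idem hx).1, ← mul_assoc, (epsProd_idem hx).1]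

instance : InverseMonoid (ExelSemigroup G) where
  mul_inv_mul := mul_inv_mul'
  inv_mul_inv s := by simpa only [inv_inv'] using mul_inv_mul' s⁻¹
  inv_unique s t h1 h2 := by
    have e1 : s * s⁻¹ * s = s := mul_inv_mul' s
    have e2 : s⁻¹ * s * s⁻¹ = s⁻¹ := by simpa only [inv_inv'] using mul_inv_mul' s⁻¹
    have c : ∀ {x y : ExelSemigroup G}, x * x = x → y * y = y → x * y = y * x :=
      fun hx hy => epsProd_comm (mem_epsProd_of_idem hx) (mem_epsProd_of_idem hy)
    have i1 : (t * s) * (t * s) = t * s := by rw [← mul_assoc, h2]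
    have i2 : (s⁻¹ * s) * (s⁻¹ * s) = s⁻¹ * s := by rw [← mul_assoc, e2]
    have i3 : (s * t) * (s * t) = s * t := by rw [← mul_assoc, h1]
    have i4 : (s * s⁻¹) * (s * s⁻¹) = s * s⁻¹ := by rw [← mul_assoc, e1]
    have a1 : t = s⁻¹ * s * t := by
      calc t = t * (s * s⁻¹ * s) * t := by rw [e1, h2]
        _ = (t * s) * (s⁻¹ * s) * t := by simp only [mul_assoc]
        _ = s⁻¹ * s * (t * s * t) := by rw [c i1 i2]; simp only [mul_assoc]
        _ = s⁻¹ * s * t := by rw [h2]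
    have a2 : s⁻¹ = s⁻¹ * s * t := by
      calc s⁻¹ = s⁻¹ * (s * t * s) * s⁻¹ := by rw [h1, e2]
        _ = s⁻¹ * ((s * t) * (s * s⁻¹)) := by simp only [mul_assoc]
        _ = (s⁻¹ * s * s⁻¹) * s * t := by rw [c i3 i4]; simp only [mul_assoc]
        _ = s⁻¹ * s * t := by rw [e2]
    rw [a1, ← a2]

end ExelSemigroup

end Exel

section Actions

/-- A partial action of a group `G` on a C*-algebra `A`: closed ideals `D g` and *-isomorphisms
`α g : D g⁻¹ → D g`. -/
structure PartialAction (G : Type v) [Group G] (A : Type u) [NonUnitalCStarAlgebra A] where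
  /-- The ideal `D_g`. -/
  D : G → ClosedIdeal A
  /-- The *-isomorphism `α_g : D_{g⁻¹} → D_g`. -/
  α : ∀ g : G, D g⁻¹ ≃⋆ₐ[ℂ] D g
  D_one : ∀ a : A, a ∈ D 1
  image_inter : ∀ g h : G,
    (fun x : D g⁻¹ => (α g x : A)) '' {x | (x : A) ∈ D h} = (D g : Set A) ∩ (D (g * h) : Set A)
  /-- `α_g (α_h x) = α_{gh} x` for `x ∈ D_{h⁻¹} ∩ D_{h⁻¹g⁻¹}`; here `x`, `y` are the same element
  of `A`, and `z` is `α_h x`, which lies in `D_{g⁻¹}` by the previous condition. -/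
  comp : ∀ (g h : G) (x : D h⁻¹) (y : D (g * h)⁻¹) (z : D g⁻¹),
    (y : A) = x → (z : A) = α h x → (α g z : A) = α (g * h) y

/-- An action of an inverse semigroup `S` with unit on a C*-algebra `A`: closed ideals `E s` and
*-isomorphisms `β s : E s⁻¹ → E s` with `β_r ∘ β_s = β_{rs}` as partially defined maps
(equality of the domains and of the values), and `E_e = A`. -/
structure InvAction (S : Type v) [InverseMonoid S] (A : Type u) [NonUnitalCStarAlgebra A] where
  /-- The ideal `E_s`. -/
  E : S → ClosedIdeal A
  /-- The *-isomorphism `β_s : E_{s*} → E_s`. -/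
  β : ∀ s : S, E s⁻¹ ≃⋆ₐ[ℂ] E s
  E_one : ∀ a : A, a ∈ E 1
  mem_comp : ∀ (r s : S) (x : A),
    x ∈ E (r * s)⁻¹ ↔ ∃ hx : x ∈ E s⁻¹, (β s ⟨x, hx⟩ : A) ∈ E r⁻¹
  comp : ∀ (r s : S) (x : E s⁻¹) (y : E (r * s)⁻¹) (z : E r⁻¹),
    (y : A) = x → (z : A) = β s x → (β r z : A) = β (r * s) y

/-- A common framework for the two kinds of actions above, used to build the algebra of finite sums
`∑ a_s δ_s`, `a_s ∈ D_s`, once for both. -/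
structure System (S : Type v) [Monoid S] [InvolutiveInv S] (A : Type u)
    [NonUnitalCStarAlgebra A] where
  D : S → ClosedIdeal A
  θ : ∀ s : S, D s⁻¹ ≃⋆ₐ[ℂ] D s
  mul_inv_rev : ∀ r s : S, (r * s)⁻¹ = s⁻¹ * r⁻¹
  mem_one : ∀ a : A, a ∈ D 1
  θ_one : ∀ x : D 1⁻¹, (θ 1 x : A) = x
  θ_mem : ∀ (r s : S) (x : D r⁻¹), (x : A) ∈ D s → (θ r x : A) ∈ D (r * s)
  θ_inv : ∀ (s : S) (x : D s⁻¹⁻¹) (y : D s), (x : A) = y → (θ s⁻¹ x : A) = (θ s).symm y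
  comp_mem : ∀ (r s : S) (x : D s⁻¹), (x : A) ∈ D (r * s)⁻¹ → (θ s x : A) ∈ D r⁻¹
  comp : ∀ (r s : S) (x : D s⁻¹) (y : D (r * s)⁻¹) (z : D r⁻¹),
    (y : A) = x → (z : A) = θ s x → (θ r z : A) = θ (r * s) y

variable {A : Type u} [NonUnitalCStarAlgebra A]

namespace PartialAction

variable {G : Type v} [Group G] (P : PartialAction G A)

theorem α_congr {g h : G} (e : g = h) (x : P.D g⁻¹) (y : P.D h⁻¹) (hxy : (x : A) = y) :
    (P.α g x : A) = P.α h y := by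
  subst e; congr 2; exact Subtype.ext hxy

theorem mem_congr {g h : G} (e : g = h) {x : A} (hx : x ∈ P.D g) : x ∈ P.D h := e ▸ hx

theorem α_mem {g h : G} (x : P.D g⁻¹) (hx : (x : A) ∈ P.D h) : (P.α g x : A) ∈ P.D (g * h) :=
  ((P.image_inter g h).subset ⟨x, hx, rfl⟩).2

theorem α_one (x : P.D 1⁻¹) : (P.α 1 x : A) = x := by
  have h := P.comp 1 1 x ⟨x, P.mem_congr (by simp) x.2⟩ ⟨P.α 1 x, P.mem_congr (by simp) (P.α 1 x).2⟩
    rfl rfl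
  rw [P.α_congr (mul_one 1) _ x rfl] at h
  have := (P.α 1).injective (Subtype.ext h)
  exact congrArg Subtype.val this

theorem α_inv (g : G) (x : P.D g⁻¹⁻¹) (y : P.D g) (hxy : (x : A) = y) :
    (P.α g⁻¹ x : A) = (P.α g).symm y := by
  obtain ⟨z, rfl⟩ := EquivLike.surjective (P.α g) y
  rw [StarAlgEquiv.symm_apply_apply]
  have h := P.comp g⁻¹ g z ⟨z, P.mem_congr (by simp) (P.D_one z)⟩ x rfl hxy
  rw [h, P.α_congr (inv_mul_cancel g) _ ⟨z, P.mem_congr (by simp) (P.D_one z)⟩ rfl, α_one]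

/-- The finite sums over `G`. -/
abbrev toSystem : System G A where
  D := P.D
  θ := P.α
  mul_inv_rev := _root_.mul_inv_rev
  mem_one := P.D_one
  θ_one := P.α_one
  θ_mem _ _ := P.α_mem
  θ_inv := P.α_inv
  comp_mem r s x hx := P.mem_congr (by simp) (P.α_mem x hx)
  comp := P.comp

end PartialAction

namespace InvAction

variable {S : Type v} [InverseMonoid S] (P : InvAction S A)

theorem β_congr {g h : S} (e : g = h) (x : P.E g⁻¹) (y : P.E h⁻¹) (hxy : (x : A) = y) :
    (P.β g x : A) = P.β h y := by
  subst e; congr 2; exact Subtype.ext hxy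

theorem mem_congr {g h : S} (e : g = h) {x : A} (hx : x ∈ P.E g) : x ∈ P.E h := e ▸ hx

theorem E_mul_le {s t : S} {x : A} (hx : x ∈ P.E (s * t)) : x ∈ P.E s := by
  have h : x ∈ P.E (t⁻¹ * s⁻¹)⁻¹ :=
    P.mem_congr (by rw [InverseMonoid.mul_inv_rev, inv_inv, inv_inv]) hx
  obtain ⟨h, -⟩ := (P.mem_comp _ _ _).1 h
  exact P.mem_congr (inv_inv s) h

/-- The isomorphism attached to an idempotent is the identity. -/
theorem β_idem {e : S} (he : e * e = e) (x : P.E e⁻¹) : (P.β e x : A) = x := by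
  have h := P.comp e e x ⟨x, P.mem_congr (by rw [he]) x.2⟩
    ⟨P.β e x, P.mem_congr (InverseMonoid.inv_of_idem he).symm (P.β e x).2⟩ rfl rfl
  rw [P.β_congr he _ x rfl] at h
  exact congrArg Subtype.val ((P.β e).injective (Subtype.ext h))

theorem β_inv (s : S) (x : P.E s⁻¹⁻¹) (y : P.E s) (hxy : (x : A) = y) :
    (P.β s⁻¹ x : A) = (P.β s).symm y := by
  obtain ⟨z, rfl⟩ := EquivLike.surjective (P.β s) y
  rw [StarAlgEquiv.symm_apply_apply]
  have hz : (z : A) ∈ P.E (s⁻¹ * s)⁻¹ :=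
    (P.mem_comp _ _ _).2 ⟨z.2, P.mem_congr (inv_inv s).symm (P.β s z).2⟩
  rw [P.comp s⁻¹ s z ⟨z, hz⟩ x rfl hxy, β_idem]
  exact InverseMonoid.idem_inv_mul s

/-- The finite sums over `S`. -/
abbrev toSystem : System S A where
  D := P.E
  θ := P.β
  mul_inv_rev := InverseMonoid.mul_inv_rev
  mem_one := P.E_one
  θ_one := P.β_idem (mul_one 1)
  θ_mem r s x hx := by
    have h : (P.β r x : A) ∈ P.E (s⁻¹ * r⁻¹)⁻¹ := by
      rw [P.mem_comp]
      refine ⟨P.mem_congr (inv_inv r).symm (P.β r x).2, ?_⟩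
      rw [P.β_inv r _ (P.β r x) rfl, StarAlgEquiv.symm_apply_apply]
      exact P.mem_congr (inv_inv s).symm hx
    exact P.mem_congr (by rw [InverseMonoid.mul_inv_rev, inv_inv, inv_inv]) h
  θ_inv := P.β_inv
  comp_mem r s x hx := ((P.mem_comp _ _ _).1 hx).2
  comp := P.comp

/-- If `r ≤ t` then `E_r ⊆ E_t`. -/
theorem E_le {r t : S} (h : InverseMonoid.NatLE r t) {x : A} (hx : x ∈ P.E r) : x ∈ P.E t := by
  obtain ⟨f, -, rfl⟩ := h
  exact P.E_mul_le hx

/-- If `r ≤ t` then `β_r` is the restriction of `β_t`. -/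
theorem β_le {r t : S} (h : InverseMonoid.NatLE r t) (x : P.E r⁻¹) (y : P.E t⁻¹)
    (hxy : (x : A) = y) : (P.β r x : A) = P.β t y := by
  obtain ⟨f, hf, rfl⟩ := h
  have h1 := (P.mem_comp _ _ _).1 x.2
  obtain ⟨h1, -⟩ := h1
  exact (P.comp t f ⟨x, h1⟩ x y rfl (by rw [P.β_idem hf, hxy])).symm

end InvAction

end Actions

section AlgebraicCrossedProduct

variable {A : Type u} [NonUnitalCStarAlgebra A]

namespace System

variable {S : Type v} [Monoid S] [InvolutiveInv S] (T : System S A)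

/-- The finite sums `∑ a_s δ_s` with `a_s ∈ D_s`. -/
def Alg : Type (max v u) := DirectSum S fun s => T.D s

noncomputable instance : AddCommGroup T.Alg :=
  inferInstanceAs (AddCommGroup (DirectSum S fun s => T.D s))

noncomputable instance : Module ℂ T.Alg :=
  inferInstanceAs (Module ℂ (DirectSum S fun s => T.D s))

open scoped Classical in
/-- The element `a δ_s`. -/
noncomputable def single (s : S) : T.D s →ₗ[ℂ] T.Alg := DirectSum.lof ℂ S (fun s => T.D s) s

theorem single_congr {s t : S} (h : s = t) (a : T.D s) (b : T.D t) (hab : (a : A) = b) :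
    T.single s a = T.single t b := by
  subst h; congr 1; exact Subtype.ext hab

theorem mem_congr {g h : S} (e : g = h) {x : A} (hx : x ∈ T.D g) : x ∈ T.D h := e ▸ hx

theorem alg_induction {p : T.Alg → Prop} (h0 : p 0) (h1 : ∀ s a, p (T.single s a))
    (h2 : ∀ x y, p x → p y → p (x + y)) (x : T.Alg) : p x := by
  classical
  refine DirectSum.induction_on x h0 (fun s a => ?_) h2
  convert! h1 s a using 1

open scoped Classical in
/-- The linear map out of the finite sums given on each summand. -/
noncomputable def linearLift {M : Type w} [AddCommGroup M] [Module ℂ M]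
    (f : ∀ s, T.D s →ₗ[ℂ] M) : T.Alg →ₗ[ℂ] M :=
  DirectSum.toModule ℂ S M f

@[simp]
theorem linearLift_single {M : Type w} [AddCommGroup M] [Module ℂ M]
    (f : ∀ s, T.D s →ₗ[ℂ] M) (s : S) (a : T.D s) : T.linearLift f (T.single s a) = f s a :=
  by classical exact DirectSum.toModule_lof ..

/-- The element `θ_r⁻¹(a) b ∈ D_{r⁻¹} ∩ D_s`. -/
noncomputable def preCoeff (r s : S) (a : T.D r) (b : T.D s) : T.D r⁻¹ :=
  ⟨((T.θ r).symm a : A) * b, (T.D r⁻¹).mul_mem_right _ ((T.θ r).symm a).2⟩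

/-- The coefficient `θ_r(θ_r⁻¹(a) b) ∈ D_{rs}` of the product `(a δ_r)(b δ_s)`. -/
noncomputable def mulCoeff (r s : S) (a : T.D r) (b : T.D s) : T.D (r * s) :=
  ⟨T.θ r (T.preCoeff r s a b), T.θ_mem r s _ ((T.D s).mul_mem_left _ b.2)⟩

/-- `(a, b) ↦ (a δ_r)(b δ_s)` as a bilinear map. -/
noncomputable def mulSingle (r s : S) : T.D r →ₗ[ℂ] T.D s →ₗ[ℂ] T.Alg :=
  LinearMap.mk₂ ℂ (fun a b => T.single (r * s) (T.mulCoeff r s a b))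
    (fun a a' b => by
      have h : T.preCoeff r s (a + a') b = T.preCoeff r s a b + T.preCoeff r s a' b := by
        ext; simp [preCoeff, add_mul]
      rw [← map_add]; congr 1; ext
      simp only [mulCoeff, h, map_add, AddMemClass.coe_add])
    (fun c a b => by
      have h : T.preCoeff r s (c • a) b = c • T.preCoeff r s a b := by
        ext; simp [preCoeff, smul_mul_assoc]
      rw [← map_smul]; congr 1; ext
      simp only [mulCoeff, h, map_smul, SetLike.val_smul])
    (fun a b b' => by
      have h : T.preCoeff r s a (b + b') = T.preCoeff r s a b + T.preCoeff r s a b' := by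
        ext; simp [preCoeff, mul_add]
      rw [← map_add]; congr 1; ext
      simp only [mulCoeff, h, map_add, AddMemClass.coe_add])
    (fun c a b => by
      have h : T.preCoeff r s a (c • b) = c • T.preCoeff r s a b := by
        ext; simp [preCoeff, mul_smul_comm]
      rw [← map_smul]; congr 1; ext
      simp only [mulCoeff, h, map_smul, SetLike.val_smul])

/-- The product of finite sums, the bilinear extension of
`(a δ_r)(b δ_s) = θ_r(θ_r⁻¹(a) b) δ_{rs}`. -/
noncomputable def mulMap : T.Alg →ₗ[ℂ] T.Alg →ₗ[ℂ] T.Alg :=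
  T.linearLift fun r => (T.linearLift fun s => (T.mulSingle r s).flip).flip

noncomputable instance : Mul T.Alg := ⟨fun x y => T.mulMap x y⟩

theorem mul_def (x y : T.Alg) : x * y = T.mulMap x y := rfl

theorem single_mul_single (r s : S) (a : T.D r) (b : T.D s) :
    T.single r a * T.single s b = T.single (r * s) (T.mulCoeff r s a b) := by
  rw [mul_def, mulMap, linearLift_single, LinearMap.flip_apply, linearLift_single]
  rfl

/-- The key identity behind associativity, a consequence of the existence of approximate units in
the closed ideals. -/
theorem mul_θ (s : S) (a c : A) (b : T.D s) :
    a * (T.θ s ⟨((T.θ s).symm b : A) * c, (T.D s⁻¹).mul_mem_right _ ((T.θ s).symm b).2⟩ : A) =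
      T.θ s ⟨((T.θ s).symm ⟨a * b, (T.D s).mul_mem_left _ b.2⟩ : A) * c,
        (T.D s⁻¹).mul_mem_right _ ((T.θ s).symm _).2⟩ := by
  have c1 : Continuous (T.θ s) := (StarAlgEquiv.isometry (T.θ s)).continuous
  have c2 : Continuous (T.θ s).symm := (StarAlgEquiv.isometry (T.θ s).symm).continuous
  have step : ∀ e : T.D s,
      a * (T.θ s ⟨((T.θ s).symm (b * e) : A) * c,
        (T.D s⁻¹).mul_mem_right _ ((T.θ s).symm (b * e)).2⟩ : A) =
      T.θ s ⟨((T.θ s).symm ⟨a * ((b * e : T.D s) : A), (T.D s).mul_mem_left _ (b * e).2⟩ : A) * c,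
        (T.D s⁻¹).mul_mem_right _ ((T.θ s).symm _).2⟩ := by
    intro e
    have key : ∀ b' : T.D s, ∀ h, (T.θ s ⟨((T.θ s).symm (b' * e) : A) * c, h⟩ : A) =
        b' * (T.θ s ⟨((T.θ s).symm e : A) * c,
          (T.D s⁻¹).mul_mem_right _ ((T.θ s).symm e).2⟩ : A) := by
      intro b' h
      have : (⟨((T.θ s).symm (b' * e) : A) * c, h⟩ : T.D s⁻¹) = (T.θ s).symm b' *
          ⟨((T.θ s).symm e : A) * c, (T.D s⁻¹).mul_mem_right _ ((T.θ s).symm e).2⟩ := by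
        ext; simp [mul_assoc]
      rw [this, map_mul, StarAlgEquiv.apply_symm_apply]
      rfl
    have e1 : (⟨a * ((b * e : T.D s) : A), (T.D s).mul_mem_left _ (b * e).2⟩ : T.D s) =
        ⟨a * b, (T.D s).mul_mem_left _ b.2⟩ * e := by
      ext; simp [mul_assoc]
    simp only [e1]
    rw [key b, key ⟨a * b, _⟩, mul_assoc]
  obtain ⟨l, hl, he, ht⟩ := (T.D s).exists_approx
  obtain ⟨l', hl', h'⟩ : ∃ l' : Filter (T.D s), l'.NeBot ∧ Tendsto (fun e => b * e) l' (𝓝 b) := by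
    refine ⟨l.comap Subtype.val, ?_, ?_⟩
    · rw [comap_neBot_iff_frequently]
      exact (he.mono fun e h => ⟨⟨e, h.1⟩, rfl⟩).frequently
    · rw [tendsto_subtype_rng]
      exact (ht b b.2).comp tendsto_comap
  have f1 : Continuous fun b : T.D s => a * (T.θ s ⟨((T.θ s).symm b : A) * c,
        (T.D s⁻¹).mul_mem_right _ ((T.θ s).symm b).2⟩ : A) := by
    refine continuous_const.mul (continuous_subtype_val.comp (c1.comp ?_))
    exact Continuous.subtype_mk ((continuous_subtype_val.comp c2).mul continuous_const) _
  have f2 : Continuous fun b : T.D s => (T.θ s ⟨((T.θ s).symm ⟨a * b,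
        (T.D s).mul_mem_left _ b.2⟩ : A) * c,
        (T.D s⁻¹).mul_mem_right _ ((T.θ s).symm _).2⟩ : A) := by
    refine continuous_subtype_val.comp (c1.comp ?_)
    refine Continuous.subtype_mk ((continuous_subtype_val.comp (c2.comp ?_)).mul
      continuous_const) _
    exact Continuous.subtype_mk (continuous_const.mul continuous_subtype_val) _
  refine tendsto_nhds_unique ((f1.tendsto b).comp h') ?_
  exact ((f2.tendsto b).comp h').congr fun e => (step e).symm

theorem θ_congr {g h : S} (e : g = h) (x : T.D g⁻¹) (y : T.D h⁻¹) (hxy : (x : A) = y) :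
    (T.θ g x : A) = T.θ h y := by
  subst e; congr 2; exact Subtype.ext hxy

theorem symm_mem (r s : S) (y : T.D s) (hy : (y : A) ∈ T.D r⁻¹) :
    ((T.θ s).symm y : A) ∈ T.D (r * s)⁻¹ := by
  have := T.θ_mem s⁻¹ r⁻¹ ⟨y, T.mem_congr (inv_inv s).symm y.2⟩ hy
  rw [T.θ_inv s _ y rfl] at this
  exact T.mem_congr (T.mul_inv_rev r s).symm this

/-- `θ_{rs}⁻¹(θ_r(y)) = θ_s⁻¹(y)` for `y ∈ D_{r⁻¹} ∩ D_s`. -/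
theorem symm_θ (r s : S) (y : T.D r⁻¹) (y' : T.D s) (x : T.D (r * s)) (h : (y' : A) = y)
    (hx : (x : A) = T.θ r y) : ((T.θ (r * s)).symm x : A) = (T.θ s).symm y' := by
  have hm := T.symm_mem r s y' (h ▸ y.2)
  have := T.comp r s ((T.θ s).symm y') ⟨_, hm⟩ y rfl (by rw [StarAlgEquiv.apply_symm_apply, h])
  have hx' : x = T.θ (r * s) ⟨_, hm⟩ := Subtype.ext (hx.trans this)
  rw [hx', StarAlgEquiv.symm_apply_apply]

protected theorem mul_assoc (x y z : T.Alg) : x * y * z = x * (y * z) := by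
  simp only [mul_def]
  induction x using T.alg_induction with
  | h0 => simp
  | h2 x x' h h' => simp only [map_add, LinearMap.add_apply, h, h']
  | h1 r a =>
  induction y using T.alg_induction with
  | h0 => simp
  | h2 x x' h h' => simp only [map_add, LinearMap.add_apply, h, h']
  | h1 s b =>
  induction z using T.alg_induction with
  | h0 => simp
  | h2 x x' h h' => simp only [map_add, h, h']
  | h1 t c =>
  simp only [← mul_def, single_mul_single]
  refine T.single_congr (mul_assoc r s t) _ _ ?_
  set a' := (T.θ r).symm a with ha'
  have hab : (a' : A) * b ∈ T.D r⁻¹ := (T.D r⁻¹).mul_mem_right _ a'.2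
  have hab' : (a' : A) * b ∈ T.D s := (T.D s).mul_mem_left _ b.2
  set z := (T.θ s).symm ⟨(a' : A) * b, hab'⟩ with hz
  have e1 : ((T.θ (r * s)).symm (T.mulCoeff r s a b) : A) = z :=
    T.symm_θ r s ⟨_, hab⟩ ⟨_, hab'⟩ _ rfl rfl
  have hzm : (z : A) ∈ T.D (r * s)⁻¹ := T.symm_mem r s _ hab
  have hzc : (z : A) * c ∈ T.D s⁻¹ := (T.D s⁻¹).mul_mem_right _ z.2
  have hzc' : (z : A) * c ∈ T.D (r * s)⁻¹ := (T.D (r * s)⁻¹).mul_mem_right _ hzm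
  have e2 : ((T.mulCoeff (r * s) t (T.mulCoeff r s a b) c : T.D (r * s * t)) : A) =
      T.θ (r * s) ⟨(z : A) * c, hzc'⟩ := by
    refine T.θ_congr rfl (T.preCoeff (r * s) t (T.mulCoeff r s a b) c) _ ?_
    simp only [preCoeff, e1]
  rw [e2, ← T.comp r s ⟨_, hzc⟩ ⟨_, hzc'⟩ ⟨_, T.comp_mem r s ⟨_, hzc⟩ hzc'⟩ rfl rfl]
  refine T.θ_congr rfl _ (T.preCoeff r (s * t) a (T.mulCoeff s t b c)) ?_
  simp only [preCoeff, mulCoeff]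
  exact (T.mul_θ s a' c b).symm

noncomputable instance : NonUnitalRing T.Alg where
  left_distrib x y z := by simp only [mul_def, map_add]
  right_distrib x y z := by simp only [mul_def, map_add, LinearMap.add_apply]
  zero_mul x := by simp only [mul_def, map_zero, LinearMap.zero_apply]
  mul_zero x := by simp only [mul_def, map_zero]
  mul_assoc := T.mul_assoc

instance : IsScalarTower ℂ T.Alg T.Alg where
  smul_assoc c x y := by simp only [smul_eq_mul, mul_def, map_smul, LinearMap.smul_apply]

instance : SMulCommClass ℂ T.Alg T.Alg where
  smul_comm c x y := by simp only [smul_eq_mul, mul_def, map_smul]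

/-- The coefficient `θ_s⁻¹(a*) ∈ D_{s⁻¹}` of `(a δ_s)*`. -/
noncomputable def starCoeff (s : S) (a : T.D s) : T.D s⁻¹ := (T.θ s).symm (star a)

open scoped Classical in
/-- The involution of finite sums, the additive extension of `(a δ_s)* = θ_s⁻¹(a*) δ_{s⁻¹}`. -/
noncomputable def starMap : T.Alg →+ T.Alg :=
  DirectSum.toAddMonoid fun s => AddMonoidHom.mk' (fun a => T.single s⁻¹ (T.starCoeff s a))
    (fun a b => by rw [← map_add]; congr 1; simp only [starCoeff, star_add, map_add])

noncomputable instance : Star T.Alg := ⟨T.starMap⟩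

theorem star_def (x : T.Alg) : star x = T.starMap x := rfl

theorem star_single (s : S) (a : T.D s) :
    star (T.single s a) = T.single s⁻¹ (T.starCoeff s a) := by
  classical exact DirectSum.toAddMonoid_of ..

noncomputable instance : StarRing T.Alg where
  star_add x y := by simp only [star_def, map_add]
  star_involutive x := by
    simp only [star_def]
    induction x using T.alg_induction with
    | h0 => simp
    | h2 x x' h h' => simp only [map_add, h, h']
    | h1 s a =>
    simp only [← star_def, star_single]
    refine T.single_congr (inv_inv s) _ _ ?_
    have h : star (T.starCoeff s a) = (T.θ s).symm a := by
      rw [starCoeff, ← map_star, star_star]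
    rw [starCoeff, h]
    obtain ⟨y, rfl⟩ := EquivLike.surjective (T.θ s) a
    rw [StarAlgEquiv.symm_apply_apply]
    have hm : (T.θ s y : A) ∈ T.D s⁻¹⁻¹ := T.mem_congr (inv_inv s).symm (T.θ s y).2
    have : T.θ s⁻¹ ⟨_, hm⟩ = y := by
      ext
      rw [T.θ_inv s _ (T.θ s y) rfl, StarAlgEquiv.symm_apply_apply]
    rw [← this, StarAlgEquiv.symm_apply_apply, this]
  star_mul x y := by
    simp only [star_def, mul_def]
    induction x using T.alg_induction with
    | h0 => simp
    | h2 x x' h h' => simp only [map_add, LinearMap.add_apply, h, h']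
    | h1 r a =>
    induction y using T.alg_induction with
    | h0 => simp
    | h2 x x' h h' => simp only [map_add, LinearMap.add_apply, h, h']
    | h1 s b =>
    simp only [← star_def, ← mul_def, star_single, single_mul_single]
    refine T.single_congr (T.mul_inv_rev r s) _ _ ?_
    set a' := (T.θ r).symm a with ha'
    have hab : (a' : A) * b ∈ T.D r⁻¹ := (T.D r⁻¹).mul_mem_right _ a'.2
    have hab' : (a' : A) * b ∈ T.D s := (T.D s).mul_mem_left _ b.2
    have e1 : (T.starCoeff (r * s) (T.mulCoeff r s a b) : A) =
        (T.θ s).symm (star ⟨_, hab'⟩) := by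
      refine T.symm_θ r s (star ⟨_, hab⟩) _ _ rfl ?_
      rw [map_star]; rfl
    rw [e1, ← T.θ_inv s ⟨star ((a' : A) * b), T.mem_congr (inv_inv s).symm
      (star_mem hab')⟩ _ rfl]
    refine T.θ_congr rfl _ (T.preCoeff s⁻¹ r⁻¹ (T.starCoeff s b) (T.starCoeff r a)) ?_
    simp only [star_mul, preCoeff]
    congr 1
    · have hm : star (b : A) ∈ T.D s⁻¹⁻¹ := T.mem_congr (inv_inv s).symm (star_mem b.2)
      have : T.θ s⁻¹ ⟨_, hm⟩ = T.starCoeff s b := by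
        ext
        rw [T.θ_inv s _ (star b) rfl]; rfl
      rw [← this, StarAlgEquiv.symm_apply_apply]
    · rw [starCoeff, map_star]; rfl

instance : StarModule ℂ T.Alg where
  star_smul c x := by
    simp only [star_def]
    induction x using T.alg_induction with
    | h0 => simp
    | h2 x x' h h' => simp only [map_add, smul_add, h, h']
    | h1 s a =>
    rw [← map_smul]
    simp only [← star_def, star_single]
    rw [← map_smul]
    congr 1
    rw [starCoeff, starCoeff, star_smul, map_smul]

end System

end AlgebraicCrossedProduct

section Quotients

variable {B : Type w} [NonUnitalRing B] [Module ℂ B]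

/-- The two-sided ideal of the algebra `B` generated by the set `X`. -/
def idealSpan (X : Set B) : Submodule ℂ B :=
  sInf {I | X ⊆ I ∧ ∀ b x : B, x ∈ I → b * x ∈ I ∧ x * b ∈ I}

theorem subset_idealSpan (X : Set B) : X ⊆ idealSpan X := by
  intro x hx
  simp only [idealSpan, SetLike.mem_coe, Submodule.mem_sInf]
  exact fun I hI => hI.1 hx

theorem mul_mem_idealSpan (X : Set B) (b : B) {x : B} (hx : x ∈ idealSpan X) :
    b * x ∈ idealSpan X ∧ x * b ∈ idealSpan X := by
  simp only [idealSpan, Submodule.mem_sInf] at hx ⊢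
  exact ⟨fun I hI => (hI.2 b x (hx I hI)).1, fun I hI => (hI.2 b x (hx I hI)).2⟩

theorem idealSpan_le {X : Set B} {I : Submodule ℂ B} (h : X ⊆ I)
    (h' : ∀ b x : B, x ∈ I → b * x ∈ I ∧ x * b ∈ I) : idealSpan X ≤ I :=
  sInf_le ⟨h, h'⟩

theorem star_mem_idealSpan [StarRing B] [StarModule ℂ B] {X : Set B}
    (h : ∀ x ∈ X, star x ∈ X) {x : B} (hx : x ∈ idealSpan X) : star x ∈ idealSpan X := by
  let I : Submodule ℂ B :=
    { carrier := {x | star x ∈ idealSpan X}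
      add_mem' := fun {a b} ha hb => by
        simp only [Set.mem_ofPred_eq, star_add] at *; exact add_mem ha hb
      zero_mem' := by simp
      smul_mem' := fun c x hx => by
        simp only [Set.mem_ofPred_eq, star_smul] at *; exact Submodule.smul_mem _ _ hx }
  refine idealSpan_le (I := I) (fun x hx => subset_idealSpan X (h x hx)) (fun b x hx => ?_) hx
  change star (b * x) ∈ idealSpan X ∧ star (x * b) ∈ idealSpan X
  rw [star_mul, star_mul]
  exact ⟨(mul_mem_idealSpan X (star b) hx).2, (mul_mem_idealSpan X (star b) hx).1⟩

/-- A self-adjoint two-sided ideal of a *-algebra. -/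
structure StarIdeal (B : Type w) [NonUnitalRing B] [StarRing B] [Module ℂ B] extends
    Submodule ℂ B where
  mul_mem' : ∀ (b : B) {x : B}, x ∈ carrier → b * x ∈ carrier ∧ x * b ∈ carrier
  star_mem' : ∀ {x : B}, x ∈ carrier → star x ∈ carrier

namespace StarIdeal

variable [StarRing B] [StarModule ℂ B] [IsScalarTower ℂ B B] [SMulCommClass ℂ B B]
  (I : StarIdeal B)

/-- The quotient *-algebra `B / I`. -/
def Quot : Type w := B ⧸ I.toSubmodule

instance : AddCommGroup I.Quot := inferInstanceAs (AddCommGroup (B ⧸ I.toSubmodule))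

instance : Module ℂ I.Quot := inferInstanceAs (Module ℂ (B ⧸ I.toSubmodule))

/-- The quotient map. -/
def mkLin : B →ₗ[ℂ] I.Quot := I.toSubmodule.mkQ

theorem mkLin_surjective : Function.Surjective I.mkLin := I.toSubmodule.mkQ_surjective

theorem mkLin_eq_iff {x y : B} : I.mkLin x = I.mkLin y ↔ x - y ∈ I.toSubmodule :=
  Submodule.Quotient.eq _

instance : Mul I.Quot where
  mul := Quotient.map₂ (· * ·) (by
    intro a a' h b b' k
    have h := (Submodule.quotientRel_def _).1 h
    have k := (Submodule.quotientRel_def _).1 k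
    refine (Submodule.quotientRel_def _).2 ?_
    have : a * b - a' * b' = (a - a') * b + a' * (b - b') := by noncomm_ring
    rw [this]
    exact add_mem (I.mul_mem' b h).2 (I.mul_mem' a' k).1)

instance : Star I.Quot where
  star := Quotient.map star (by
    intro a a' h
    have h := (Submodule.quotientRel_def _).1 h
    refine (Submodule.quotientRel_def _).2 ?_
    rw [← star_sub]
    exact I.star_mem' h)

theorem mkLin_mul (x y : B) : I.mkLin (x * y) = I.mkLin x * I.mkLin y := rfl

theorem mkLin_star (x : B) : I.mkLin (star x) = star (I.mkLin x) := rfl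

instance : NonUnitalRing I.Quot where
  left_distrib x y z := by
    obtain ⟨x, rfl⟩ := I.mkLin_surjective x
    obtain ⟨y, rfl⟩ := I.mkLin_surjective y
    obtain ⟨z, rfl⟩ := I.mkLin_surjective z
    simp only [← mkLin_mul, ← map_add, mul_add]
  right_distrib x y z := by
    obtain ⟨x, rfl⟩ := I.mkLin_surjective x
    obtain ⟨y, rfl⟩ := I.mkLin_surjective y
    obtain ⟨z, rfl⟩ := I.mkLin_surjective z
    simp only [← mkLin_mul, ← map_add, add_mul]
  zero_mul x := by
    obtain ⟨x, rfl⟩ := I.mkLin_surjective x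
    rw [← map_zero I.mkLin, ← mkLin_mul, zero_mul]
  mul_zero x := by
    obtain ⟨x, rfl⟩ := I.mkLin_surjective x
    rw [← map_zero I.mkLin, ← mkLin_mul, mul_zero]
  mul_assoc x y z := by
    obtain ⟨x, rfl⟩ := I.mkLin_surjective x
    obtain ⟨y, rfl⟩ := I.mkLin_surjective y
    obtain ⟨z, rfl⟩ := I.mkLin_surjective z
    simp only [← mkLin_mul, mul_assoc]

instance : StarRing I.Quot where
  star_involutive x := by
    obtain ⟨x, rfl⟩ := I.mkLin_surjective x
    simp only [← mkLin_star, star_star]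
  star_mul x y := by
    obtain ⟨x, rfl⟩ := I.mkLin_surjective x
    obtain ⟨y, rfl⟩ := I.mkLin_surjective y
    simp only [← mkLin_star, ← mkLin_mul, star_mul]
  star_add x y := by
    obtain ⟨x, rfl⟩ := I.mkLin_surjective x
    obtain ⟨y, rfl⟩ := I.mkLin_surjective y
    simp only [← mkLin_star, ← map_add, star_add]

instance : StarModule ℂ I.Quot where
  star_smul c x := by
    obtain ⟨x, rfl⟩ := I.mkLin_surjective x
    simp only [← mkLin_star, ← map_smul, star_smul]

instance : IsScalarTower ℂ I.Quot I.Quot where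
  smul_assoc c x y := by
    obtain ⟨x, rfl⟩ := I.mkLin_surjective x
    obtain ⟨y, rfl⟩ := I.mkLin_surjective y
    simp only [smul_eq_mul, ← mkLin_mul, ← map_smul, smul_mul_assoc]

instance : SMulCommClass ℂ I.Quot I.Quot where
  smul_comm c x y := by
    obtain ⟨x, rfl⟩ := I.mkLin_surjective x
    obtain ⟨y, rfl⟩ := I.mkLin_surjective y
    simp only [smul_eq_mul, ← mkLin_mul, ← map_smul, mul_smul_comm]

/-- The quotient map as a *-homomorphism. -/
def proj : B →⋆ₙₐ[ℂ] I.Quot where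
  toFun := I.mkLin
  map_smul' := map_smul I.mkLin
  map_zero' := map_zero I.mkLin
  map_add' := map_add I.mkLin
  map_mul' := I.mkLin_mul
  map_star' := I.mkLin_star

theorem proj_surjective : Function.Surjective I.proj := I.mkLin_surjective

theorem proj_eq_iff {x y : B} : I.proj x = I.proj y ↔ x - y ∈ I.toSubmodule := I.mkLin_eq_iff

end StarIdeal

end Quotients

section Enveloping

/-- A representation of the *-algebra `B`: a *-homomorphism into the bounded operators of a complex
Hilbert space. -/
structure Rep (B : Type w) [NonUnitalRing B] [StarRing B] [Module ℂ B] where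
  H : Type w
  [normed : NormedAddCommGroup H]
  [inner : InnerProductSpace ℂ H]
  [complete : CompleteSpace H]
  π : B →⋆ₙₐ[ℂ] (H →L[ℂ] H)

attribute [instance] Rep.normed Rep.inner Rep.complete

/-- The representations of `B` are uniformly bounded at each element, so that
`sup_ρ ‖ρ(x)‖` is finite and the enveloping C*-algebra exists. -/
class BoundedReps (B : Type w) [NonUnitalRing B] [StarRing B] [Module ℂ B] : Prop where
  bdd : ∀ x : B, BddAbove (Set.range fun ρ : Rep B => ‖ρ.π x‖)

variable (B : Type w) [NonUnitalRing B] [StarRing B] [Module ℂ B]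

/-- The zero representation. -/
noncomputable def Rep.zero : Rep B where
  H := PUnit
  π := 0

instance : Nonempty (Rep B) := ⟨Rep.zero B⟩

variable {B} in
/-- The seminorm `ρ_s(x) = sup {‖ρ(x)‖ : ρ a representation of B}`. -/
noncomputable def envSeminorm (x : B) : ℝ := ⨆ ρ : Rep B, ‖ρ.π x‖

section Seminorm

variable {B} [BoundedReps B]

theorem le_envSeminorm (ρ : Rep B) (x : B) : ‖ρ.π x‖ ≤ envSeminorm x :=
  le_ciSup (BoundedReps.bdd x) ρ

theorem envSeminorm_nonneg (x : B) : 0 ≤ envSeminorm x :=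
  (norm_nonneg _).trans (le_envSeminorm (Rep.zero B) x)

theorem envSeminorm_zero : envSeminorm (0 : B) = 0 := by simp [envSeminorm]

theorem envSeminorm_add (x y : B) : envSeminorm (x + y) ≤ envSeminorm x + envSeminorm y :=
  ciSup_le fun ρ => by
    rw [map_add]
    exact (norm_add_le _ _).trans (add_le_add (le_envSeminorm ρ x) (le_envSeminorm ρ y))

theorem envSeminorm_neg (x : B) : envSeminorm (-x) = envSeminorm x := by simp [envSeminorm]

theorem envSeminorm_mul (x y : B) : envSeminorm (x * y) ≤ envSeminorm x * envSeminorm y :=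
  ciSup_le fun ρ => by
    rw [map_mul]
    exact (norm_mul_le _ _).trans (mul_le_mul (le_envSeminorm ρ x) (le_envSeminorm ρ y)
      (norm_nonneg _) (envSeminorm_nonneg x))

theorem envSeminorm_smul (c : ℂ) (x : B) : envSeminorm (c • x) ≤ ‖c‖ * envSeminorm x :=
  ciSup_le fun ρ => by
    rw [map_smul, norm_smul]
    exact mul_le_mul_of_nonneg_left (le_envSeminorm ρ x) (norm_nonneg _)

theorem envSeminorm_star (x : B) : envSeminorm (star x) = envSeminorm x := by
  simp [envSeminorm, map_star]

theorem envSeminorm_star_mul_self (x : B) : envSeminorm x * envSeminorm x ≤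
    envSeminorm (star x * x) := by
  rw [← Real.sqrt_le_sqrt_iff (envSeminorm_nonneg _), Real.sqrt_mul_self (envSeminorm_nonneg _)]
  refine ciSup_le fun ρ => Real.le_sqrt_of_sq_le ?_
  rw [sq, ← CStarRing.norm_star_mul_self, ← map_star, ← map_mul]
  exact le_envSeminorm ρ _

end Seminorm

/-- A copy of `B`, equipped with the seminorm `ρ_s`. -/
def EnvPre : Type w := B

namespace EnvPre

instance : NonUnitalRing (EnvPre B) := inferInstanceAs (NonUnitalRing B)
instance : StarRing (EnvPre B) := inferInstanceAs (StarRing B)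
instance : Module ℂ (EnvPre B) := inferInstanceAs (Module ℂ B)
instance [StarModule ℂ B] : StarModule ℂ (EnvPre B) := inferInstanceAs (StarModule ℂ B)
instance [IsScalarTower ℂ B B] : IsScalarTower ℂ (EnvPre B) (EnvPre B) :=
  inferInstanceAs (IsScalarTower ℂ B B)
instance [SMulCommClass ℂ B B] : SMulCommClass ℂ (EnvPre B) (EnvPre B) :=
  inferInstanceAs (SMulCommClass ℂ B B)

variable [BoundedReps B]

noncomputable instance : NonUnitalSeminormedRing (EnvPre B) :=
  { (inferInstance : NonUnitalRing (EnvPre B)) with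
    norm := envSeminorm (B := B)
    dist := fun x y => envSeminorm (B := B) (-x + y)
    dist_self := fun x => by
      rw [neg_add_cancel]; exact envSeminorm_zero
    dist_comm := fun x y => by
      refine (envSeminorm_neg (B := B) _).symm.trans ?_
      congr 1
      exact (by abel : -(-x + y) = -y + x)
    dist_triangle := fun x y z => by
      refine le_of_eq_of_le ?_ (envSeminorm_add (B := B) _ _)
      congr 1
      exact (by abel : -x + z = -x + y + (-y + z))
    dist_eq := fun _ _ => rfl
    norm_mul_le := envSeminorm_mul (B := B) }

theorem norm_def (x : EnvPre B) : ‖x‖ = envSeminorm (B := B) x := rfl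

noncomputable instance : NormedSpace ℂ (EnvPre B) where
  norm_smul_le := envSeminorm_smul (B := B)

instance : NormedStarGroup (EnvPre B) where
  norm_star_le x := (envSeminorm_star (B := B) x).le

end EnvPre

/-- The enveloping C*-algebra of the *-algebra `B`: the (Hausdorff) completion of `B` with respect
to `ρ_s`, which is the completion of `B / ker ρ_s`. -/
def Enveloping [BoundedReps B] : Type w := UniformSpace.Completion (EnvPre B)

namespace Enveloping

open UniformSpace

variable [BoundedReps B]

noncomputable instance : NormedAddCommGroup (Enveloping B) :=
  inferInstanceAs (NormedAddCommGroup (Completion (EnvPre B)))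

noncomputable instance : NormedSpace ℂ (Enveloping B) :=
  inferInstanceAs (NormedSpace ℂ (Completion (EnvPre B)))

instance : CompleteSpace (Enveloping B) :=
  inferInstanceAs (CompleteSpace (Completion (EnvPre B)))

/-- The canonical map of `B` into its enveloping C*-algebra, as a linear map. -/
noncomputable def ofLin : B →ₗ[ℂ] Enveloping B :=
  (Completion.toComplₗᵢ (𝕜 := ℂ) (E := EnvPre B)).toLinearMap

theorem norm_ofLin (x : B) : ‖ofLin B x‖ = envSeminorm x :=
  Completion.norm_coe (E := EnvPre B) x

theorem denseRange_ofLin : DenseRange (ofLin B) :=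
  Completion.denseRange_coe (α := EnvPre B)

theorem isDenseInducing_coe : IsDenseInducing ((↑) : EnvPre B → Completion (EnvPre B)) :=
  Completion.isDenseInducing_coe

noncomputable instance : Mul (Enveloping B) where
  mul := Function.curry <| ((isDenseInducing_coe B).prodMap (isDenseInducing_coe B)).extend
    (((↑) : EnvPre B → Completion (EnvPre B)) ∘ Function.uncurry (· * ·))

noncomputable instance : Star (Enveloping B) where
  star := Completion.map (star : EnvPre B → EnvPre B)

theorem ofLin_mul (x y : B) : ofLin B (x * y) = ofLin B x * ofLin B y :=
  (((isDenseInducing_coe B).prodMap (isDenseInducing_coe B)).extend_eq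
    ((Completion.continuous_coe (EnvPre B)).comp (continuous_mul (M := EnvPre B))) (x, y)).symm

theorem ofLin_star (x : B) : ofLin B (star x) = star (ofLin B x) :=
  (Completion.map_coe (α := EnvPre B)
    (AddMonoidHomClass.uniformContinuous_of_bound (starAddEquiv (R := EnvPre B)) 1
      (fun x => by simp)) x).symm

theorem continuous_star' : Continuous (star : Enveloping B → Enveloping B) :=
  Completion.continuous_map

instance : ContinuousMul (Enveloping B) where
  continuous_mul := by
    let m := (AddMonoidHom.mul : EnvPre B →+ EnvPre B →+ EnvPre B).compr₂ Completion.toCompl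
    have : Continuous fun p : EnvPre B × EnvPre B => m p.1 p.2 :=
      (Completion.continuous_coe _).comp continuous_mul
    have di : IsDenseInducing (Completion.toCompl : EnvPre B → Completion (EnvPre B)) :=
      isDenseInducing_coe B
    exact (di.extend_Z_bilin di this :)

variable {B}

theorem induction₁ {p : Enveloping B → Prop} (hc : IsClosed {x | p x})
    (h : ∀ x : B, p (ofLin B x)) (x : Enveloping B) : p x :=
  Completion.induction_on x hc h

theorem induction₂ {p : Enveloping B → Enveloping B → Prop}
    (hc : IsClosed {x : Enveloping B × Enveloping B | p x.1 x.2})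
    (h : ∀ x y : B, p (ofLin B x) (ofLin B y)) (x y : Enveloping B) : p x y :=
  Completion.induction_on₂ x y hc h

theorem induction₃ {p : Enveloping B → Enveloping B → Enveloping B → Prop}
    (hc : IsClosed {x : Enveloping B × Enveloping B × Enveloping B | p x.1 x.2.1 x.2.2})
    (h : ∀ x y z : B, p (ofLin B x) (ofLin B y) (ofLin B z)) (x y z : Enveloping B) : p x y z :=
  Completion.induction_on₃ x y z hc h

variable (B)

noncomputable instance : NonUnitalRing (Enveloping B) where
  zero_mul := induction₁ (isClosed_eq (by fun_prop) continuous_const) fun x => by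
    rw [← map_zero (ofLin B), ← ofLin_mul, zero_mul]
  mul_zero := induction₁ (isClosed_eq (by fun_prop) continuous_const) fun x => by
    rw [← map_zero (ofLin B), ← ofLin_mul, mul_zero]
  mul_assoc := induction₃ (isClosed_eq (by fun_prop) (by fun_prop)) fun x y z => by
    simp only [← ofLin_mul, mul_assoc]
  left_distrib := induction₃ (isClosed_eq (by fun_prop) (by fun_prop)) fun x y z => by
    simp only [← ofLin_mul, ← map_add, mul_add]
  right_distrib := induction₃ (isClosed_eq (by fun_prop) (by fun_prop)) fun x y z => by
    simp only [← ofLin_mul, ← map_add, add_mul]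

noncomputable instance : NonUnitalNormedRing (Enveloping B) where
  __ := (inferInstance : NormedAddCommGroup (Enveloping B))
  __ := (inferInstance : NonUnitalRing (Enveloping B))
  norm_mul_le := induction₂ (isClosed_le (by fun_prop) (by fun_prop)) fun x y => by
    simp only [← ofLin_mul, norm_ofLin]
    exact envSeminorm_mul x y

noncomputable instance : StarRing (Enveloping B) where
  star_involutive := induction₁
    (isClosed_eq ((continuous_star' B).comp (continuous_star' B)) continuous_id) fun x => by
    simp only [← ofLin_star, star_star]
  star_mul := induction₂ (isClosed_eq ((continuous_star' B).comp continuous_mul)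
    (((continuous_star' B).comp continuous_snd).mul ((continuous_star' B).comp continuous_fst)))
    fun x y => by simp only [← ofLin_star, ← ofLin_mul, star_mul]
  star_add := induction₂ (isClosed_eq ((continuous_star' B).comp continuous_add)
    (((continuous_star' B).comp continuous_fst).add ((continuous_star' B).comp continuous_snd)))
    fun x y => by simp only [← ofLin_star, ← map_add, star_add]

instance : CStarRing (Enveloping B) where
  norm_mul_self_le := induction₁ (isClosed_le (by fun_prop)
    ((continuous_star' B).mul continuous_id).norm) fun x => by
    simp only [← ofLin_star, ← ofLin_mul, norm_ofLin]
    exact envSeminorm_star_mul_self x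

theorem continuous_smul' (c : ℂ) : Continuous fun x : Enveloping B => c • x :=
  continuous_const_smul c

theorem smul_mul' [IsScalarTower ℂ B B] (c : ℂ) :
    ∀ x y : Enveloping B, (c • x) * y = c • (x * y) :=
  induction₂ (isClosed_eq (((continuous_smul' B c).comp continuous_fst).mul continuous_snd)
    ((continuous_smul' B c).comp continuous_mul)) fun x y => by
    simp only [← ofLin_mul, ← map_smul, smul_mul_assoc]

theorem mul_smul' [SMulCommClass ℂ B B] (c : ℂ) :
    ∀ x y : Enveloping B, x * (c • y) = c • (x * y) :=
  induction₂ (isClosed_eq (continuous_fst.mul ((continuous_smul' B c).comp continuous_snd))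
    ((continuous_smul' B c).comp continuous_mul)) fun x y => by
    simp only [← ofLin_mul, ← map_smul, mul_smul_comm]

theorem star_smul' [StarModule ℂ B] (c : ℂ) :
    ∀ x : Enveloping B, star (c • x) = star c • star x :=
  induction₁ (isClosed_eq ((continuous_star' B).comp (continuous_smul' B c))
    ((continuous_smul' B _).comp (continuous_star' B))) fun x => by
    simp only [← ofLin_star, ← map_smul, star_smul]

noncomputable instance [StarModule ℂ B] [IsScalarTower ℂ B B] [SMulCommClass ℂ B B] :
    NonUnitalCStarAlgebra (Enveloping B) where
  smul_assoc := smul_mul' B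
  smul_comm c x y := (mul_smul' B c x y).symm
  star_smul := star_smul' B

/-- The canonical *-homomorphism of `B` into its enveloping C*-algebra. -/
noncomputable def of : B →⋆ₙₐ[ℂ] Enveloping B where
  toFun := ofLin B
  map_smul' := map_smul (ofLin B)
  map_zero' := map_zero (ofLin B)
  map_add' := map_add (ofLin B)
  map_mul' := ofLin_mul B
  map_star' := ofLin_star B

end Enveloping

end Enveloping

section CrossedProducts

variable {A : Type u} [NonUnitalCStarAlgebra A]

namespace System

variable {S : Type v} [Monoid S] [InvolutiveInv S] (T : System S A)

theorem one_inv {S : Type v} [Monoid S] [InvolutiveInv S] (T : System S A) : (1 : S)⁻¹ = 1 := by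
  have h := T.mul_inv_rev 1⁻¹ 1
  rw [mul_one, inv_inv, mul_one] at h
  exact h.symm

theorem symm_θ_one (x : T.D 1) : ((T.θ 1).symm x : A) = x := by
  obtain ⟨y, rfl⟩ := EquivLike.surjective (T.θ 1) x
  rw [StarAlgEquiv.symm_apply_apply, T.θ_one]

/-- The embedding `a ↦ a δ_e` of `A`. -/
noncomputable def unitHom : A →⋆ₙₐ[ℂ] T.Alg where
  toFun a := T.single 1 ⟨a, T.mem_one a⟩
  map_smul' c a := by
    change _ = c • _
    rw [← map_smul]; rfl
  map_zero' := map_zero (T.single 1)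
  map_add' a b := by rw [← map_add]; rfl
  map_mul' a b := by
    rw [single_mul_single]
    refine (T.single_congr (mul_one 1) _ _ ?_).symm
    simp only [mulCoeff, T.θ_one, preCoeff, symm_θ_one]
  map_star' a := by
    rw [star_single]
    refine (T.single_congr T.one_inv _ _ ?_).symm
    simp only [starCoeff, symm_θ_one]
    rfl

/-- Representations of the finite sums that identify `a δ_{s*s}` with `a δ_e` are contractive on
each `a δ_s`. -/
theorem norm_single_le {H : Type w} [NormedAddCommGroup H] [InnerProductSpace ℂ H]
    [CompleteSpace H] (π : T.Alg →⋆ₙₐ[ℂ] (H →L[ℂ] H))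
    (hπ : ∀ (s : S) (a : T.D (s⁻¹ * s)),
      π (T.single (s⁻¹ * s) a) = π (T.single 1 ⟨a, T.mem_one a⟩))
    (s : S) (a : T.D s) : ‖π (T.single s a)‖ ≤ ‖a‖ := by
  have h1 : ‖π (T.single s a)‖ * ‖π (T.single s a)‖ ≤ ‖a‖ * ‖a‖ := by
    rw [← CStarRing.norm_star_mul_self, ← map_star, ← map_mul, star_single, single_mul_single, hπ]
    refine (NonUnitalStarAlgHom.norm_apply_le (π.comp T.unitHom) _).trans (le_of_eq ?_)
    have h2 : (T.mulCoeff s⁻¹ s (T.starCoeff s a) a : A) = (T.θ s).symm (star a * a) := by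
      rw [← T.θ_inv s ⟨((star a * a : T.D s) : A), T.mem_congr (inv_inv s).symm
        (star a * a : T.D s).2⟩ _ rfl]
      refine T.θ_congr rfl (T.preCoeff s⁻¹ s (T.starCoeff s a) a) _ ?_
      have hm : ((star a : T.D s) : A) ∈ T.D s⁻¹⁻¹ := T.mem_congr (inv_inv s).symm (star a).2
      have : T.θ s⁻¹ ⟨_, hm⟩ = T.starCoeff s a := by
        ext
        rw [T.θ_inv s _ (star a) rfl]; rfl
      simp only [preCoeff]
      rw [← this, StarAlgEquiv.symm_apply_apply]
      rfl
    rw [h2, ← CStarRing.norm_star_mul_self (x := a)]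
    exact StarAlgEquiv.norm_map (T.θ s).symm (star a * a)
  exact (mul_self_le_mul_self_iff (norm_nonneg _) (norm_nonneg _)).2 h1

/-- The `ℓ¹`-type bound, in qualitative form. -/
theorem exists_bound (x : T.Alg) : ∃ C : ℝ, ∀ (H : Type w) [NormedAddCommGroup H]
    [InnerProductSpace ℂ H] [CompleteSpace H] (π : T.Alg →⋆ₙₐ[ℂ] (H →L[ℂ] H)),
    (∀ (s : S) (a : T.D (s⁻¹ * s)),
      π (T.single (s⁻¹ * s) a) = π (T.single 1 ⟨a, T.mem_one a⟩)) → ‖π x‖ ≤ C := by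
  induction x using T.alg_induction with
  | h0 => exact ⟨0, fun H _ _ _ π _ => by simp⟩
  | h1 s a => exact ⟨‖a‖, fun H _ _ _ π h => T.norm_single_le π h s a⟩
  | h2 x y hx hy =>
    obtain ⟨C, hC⟩ := hx
    obtain ⟨C', hC'⟩ := hy
    refine ⟨C + C', fun H _ _ _ π h => ?_⟩
    rw [map_add]
    exact (norm_add_le _ _).trans (add_le_add (hC H π h) (hC' H π h))

end System

namespace PartialAction

variable {G : Type v} [Group G] (P : PartialAction G A)

/-- The algebraic partial crossed product of a partial action. -/
abbrev AlgCrossedProduct : Type (max v u) := P.toSystem.Alg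

/-- The element `a δ_g` of the algebraic partial crossed product. -/
noncomputable def δ (g : G) (a : P.D g) : P.AlgCrossedProduct := P.toSystem.single g a

instance : BoundedReps P.AlgCrossedProduct where
  bdd x := by
    obtain ⟨C, hC⟩ := P.toSystem.exists_bound x
    refine ⟨C, ?_⟩
    rintro _ ⟨ρ, rfl⟩
    exact hC ρ.H ρ.π fun s a => by
      rw [P.toSystem.single_congr (inv_mul_cancel s) a ⟨a, P.D_one a⟩ rfl]

/-- The partial crossed product of a partial action: the enveloping C*-algebra of the algebraic
one. -/
abbrev CrossedProduct : Type (max v u) := Enveloping P.AlgCrossedProduct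

/-- The canonical map of the algebraic partial crossed product into the partial crossed product. -/
noncomputable def ι : P.AlgCrossedProduct →⋆ₙₐ[ℂ] P.CrossedProduct :=
  Enveloping.of P.AlgCrossedProduct

end PartialAction

namespace InvAction

variable {S : Type v} [InverseMonoid S] (P : InvAction S A)

/-- The *-algebra `L` of finite sums `∑ a_s δ_s` with `a_s ∈ E_s`. -/
abbrev L : Type (max v u) := P.toSystem.Alg

/-- The element `a δ_s` of `L`. -/
noncomputable def δ (s : S) (a : P.E s) : P.L := P.toSystem.single s a

/-- The elements `a δ_r - a δ_t` with `a ∈ E_r` and `r ≤ t`. -/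
def relators : Set P.L :=
  {x | ∃ (r t : S) (h : InverseMonoid.NatLE r t) (a : P.E r),
    x = P.δ r a - P.δ t ⟨a, P.E_le h a.2⟩}

theorem star_relators (x : P.L) (hx : x ∈ P.relators) : star x ∈ P.relators := by
  obtain ⟨r, t, h, a, rfl⟩ := hx
  refine ⟨r⁻¹, t⁻¹, h.inv, P.toSystem.starCoeff r a, ?_⟩
  rw [star_sub, δ, δ, System.star_single, System.star_single]
  congr 1
  refine P.toSystem.single_congr rfl _ _ ?_
  have h1 : ((star a : P.E r) : A) ∈ P.E r⁻¹⁻¹ := P.mem_congr (inv_inv r).symm (star a).2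
  have h2 : ((star a : P.E r) : A) ∈ P.E t⁻¹⁻¹ := P.E_le h.inv.inv h1
  have := P.β_le h.inv ⟨_, h1⟩ ⟨_, h2⟩ rfl
  rw [P.β_inv r _ (star a) rfl, P.β_inv t _ (star ⟨a, P.E_le h a.2⟩) rfl] at this
  exact this.symm

/-- The ideal `N` of `L` generated by the elements `a δ_r - a δ_t` with `a ∈ E_r` and `r ≤ t`. -/
noncomputable def N : StarIdeal P.L where
  toSubmodule := idealSpan P.relators
  mul_mem' b _ hx := mul_mem_idealSpan _ b hx
  star_mem' hx := star_mem_idealSpan P.star_relators hx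

/-- The algebraic partial crossed product `L / N` of an action of an inverse semigroup. -/
abbrev AlgCrossedProduct : Type (max v u) := P.N.Quot

theorem proj_eq_of_le {r t : S} (h : InverseMonoid.NatLE r t) (a : P.E r) :
    P.N.proj (P.δ r a) = P.N.proj (P.δ t ⟨a, P.E_le h a.2⟩) :=
  (P.N.proj_eq_iff).2 (subset_idealSpan _ ⟨r, t, h, a, rfl⟩)

instance : BoundedReps P.AlgCrossedProduct where
  bdd x := by
    obtain ⟨x, rfl⟩ := P.N.proj_surjective x
    obtain ⟨C, hC⟩ := P.toSystem.exists_bound x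
    refine ⟨C, ?_⟩
    rintro _ ⟨ρ, rfl⟩
    refine hC ρ.H (ρ.π.comp P.N.proj) fun s a => ?_
    exact congrArg ρ.π (P.proj_eq_of_le ⟨_, InverseMonoid.idem_inv_mul s, (one_mul _).symm⟩ a)

/-- The partial crossed product of an action of an inverse semigroup: the enveloping C*-algebra of
the algebraic one. -/
abbrev CrossedProduct : Type (max v u) := Enveloping P.AlgCrossedProduct

/-- The canonical map of the algebraic partial crossed product into the partial crossed product. -/
noncomputable def ι : P.AlgCrossedProduct →⋆ₙₐ[ℂ] P.CrossedProduct :=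
  Enveloping.of P.AlgCrossedProduct

end InvAction

end CrossedProducts

section Correspondence

namespace ExelSemigroup

variable {G : Type v} [Group G]

/-- The map `X ↦ {1, g} ∪ gX` on the subsets of `G`. -/
def suppFun (g : G) : Function.End (Set G) := fun X => {p | p = 1 ∨ p = g ∨ g⁻¹ * p ∈ X}

/-- The action of `S(G)` on the subsets of `G` for which `[g]` acts by `X ↦ {1, g} ∪ gX`. -/
def suppHom : ExelSemigroup G →ₙ* Function.End (Set G) :=
  lift suppFun
    (fun g h => by
      funext X; ext p
      change (p = 1 ∨ p = g⁻¹ ∨ (g⁻¹⁻¹ * p = 1 ∨ g⁻¹⁻¹ * p = g ∨ (g⁻¹ * (g⁻¹⁻¹ * p) = 1 ∨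
        g⁻¹ * (g⁻¹⁻¹ * p) = h ∨ h⁻¹ * (g⁻¹ * (g⁻¹⁻¹ * p)) ∈ X))) ↔
        (p = 1 ∨ p = g⁻¹ ∨ (g⁻¹⁻¹ * p = 1 ∨ g⁻¹⁻¹ * p = g * h ∨ (g * h)⁻¹ * (g⁻¹⁻¹ * p) ∈ X))
      have e1 : g⁻¹⁻¹ * p = g ↔ p = 1 := by simp
      have e2 : g⁻¹ * (g⁻¹⁻¹ * p) = p := by simp
      have e3 : g⁻¹⁻¹ * p = g * h ↔ p = h := by simp
      have e4 : (g * h)⁻¹ * (g⁻¹⁻¹ * p) = h⁻¹ * p := by group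
      rw [e1, e2, e3, e4]; tauto)
    (fun g h => by
      funext X; ext p
      change (p = 1 ∨ p = g ∨ (g⁻¹ * p = 1 ∨ g⁻¹ * p = h ∨ (h⁻¹ * (g⁻¹ * p) = 1 ∨
        h⁻¹ * (g⁻¹ * p) = h⁻¹ ∨ h⁻¹⁻¹ * (h⁻¹ * (g⁻¹ * p)) ∈ X))) ↔
        (p = 1 ∨ p = g * h ∨ ((g * h)⁻¹ * p = 1 ∨ (g * h)⁻¹ * p = h⁻¹ ∨
          h⁻¹⁻¹ * ((g * h)⁻¹ * p) ∈ X))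
      have e1 : g⁻¹ * p = 1 ↔ p = g := by rw [inv_mul_eq_one, eq_comm]
      have e2 : g⁻¹ * p = h ↔ p = g * h := by rw [inv_mul_eq_iff_eq_mul]
      have e3 : h⁻¹ * (g⁻¹ * p) = (g * h)⁻¹ * p := by group
      have e4 : (g * h)⁻¹ * p = 1 ↔ p = g * h := by rw [inv_mul_eq_one, eq_comm]
      have e5 : (g * h)⁻¹ * p = h⁻¹ ↔ p = g := by rw [inv_mul_eq_iff_eq_mul]; simp
      rw [e3, e1, e2, e4, e5]; tauto)
    (fun g => by
      funext X; ext p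
      change (p = 1 ∨ p = g ∨ (g⁻¹ * p = 1 ∨ g⁻¹ * p = 1 ∨ 1⁻¹ * (g⁻¹ * p) ∈ X)) ↔
        (p = 1 ∨ p = g ∨ g⁻¹ * p ∈ X)
      have e1 : g⁻¹ * p = 1 ↔ p = g := by rw [inv_mul_eq_one, eq_comm]
      have e2 : (1 : G)⁻¹ * (g⁻¹ * p) = g⁻¹ * p := by simp
      rw [e1, e2]; tauto)

theorem suppHom_gen (g : G) : suppHom (gen g) = suppFun g := lift_gen _ _ _ _ g

/-- The set `{1, r₁, r₁r₂, …, r₁⋯rₙ}` attached to `s = [r₁]⋯[rₙ]`. -/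
def supp (s : ExelSemigroup G) : Set G := suppHom s ∅

theorem mem_supp_gen {g p : G} : p ∈ supp (gen g) ↔ p = 1 ∨ p = g := by
  unfold supp
  rw [suppHom_gen]
  change (p = 1 ∨ p = g ∨ False) ↔ _
  tauto

theorem mem_suppHom (s : ExelSemigroup G) (X : Set G) (p : G) :
    p ∈ suppHom s X ↔ p ∈ supp s ∨ (degree s)⁻¹ * p ∈ X := by
  unfold supp
  induction s using induction generalizing p X with
  | h0 g =>
    rw [degree_gen]
    rw [suppHom_gen]
    change (p = 1 ∨ p = g ∨ g⁻¹ * p ∈ X) ↔ ((p = 1 ∨ p = g ∨ False) ∨ g⁻¹ * p ∈ X)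
    tauto
  | h1 g s h =>
    have e : ∀ Y, p ∈ suppHom (gen g * s) Y ↔ (p = 1 ∨ p = g ∨ g⁻¹ * p ∈ suppHom s Y) := by
      intro Y
      rw [map_mul]
      change p ∈ suppHom (gen g) (suppHom s Y) ↔ _
      rw [suppHom_gen]
      rfl
    rw [e, e, h X]
    have : (degree (gen g * s))⁻¹ * p = (degree s)⁻¹ * (g⁻¹ * p) := by
      rw [map_mul, degree_gen]; group
    rw [this]; tauto

theorem mem_supp_mul (s t : ExelSemigroup G) (p : G) :
    p ∈ supp (s * t) ↔ p ∈ supp s ∨ (degree s)⁻¹ * p ∈ supp t := by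
  rw [← mem_suppHom]
  unfold supp
  rw [map_mul]; rfl

theorem degree_mem_supp (s : ExelSemigroup G) : degree s ∈ supp s := by
  induction s using induction with
  | h0 g => rw [mem_supp_gen, degree_gen]; exact Or.inr rfl
  | h1 g s h =>
    rw [mem_supp_mul]; right
    simpa using h

theorem degree_inv (s : ExelSemigroup G) : degree s⁻¹ = (degree s)⁻¹ := by
  induction s using induction with
  | h0 g => rw [gen_inv, degree_gen, degree_gen]
  | h1 g s h => rw [mul_inv_rev', map_mul, h, gen_inv, degree_gen, map_mul, degree_gen,
      _root_.mul_inv_rev]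

theorem mem_supp_inv (s : ExelSemigroup G) (p : G) : p ∈ supp s⁻¹ ↔ degree s * p ∈ supp s := by
  induction s using induction generalizing p with
  | h0 g =>
    rw [gen_inv, mem_supp_gen, degree_gen, mem_supp_gen, mul_eq_left, mul_eq_one_iff_eq_inv']
    tauto
  | h1 g s h =>
    rw [mul_inv_rev', mem_supp_mul, h, degree_inv, inv_inv, gen_inv, mem_supp_gen, mem_supp_mul,
      mem_supp_gen, degree_gen, map_mul, degree_gen]
    have e1 : g * degree s * p = 1 ↔ degree s * p = g⁻¹ := by
      rw [mul_assoc, mul_eq_one_iff_eq_inv']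
    have e2 : g * degree s * p = g ↔ degree s * p = 1 := by
      rw [mul_assoc, mul_eq_left]
    have e3 : g⁻¹ * (g * degree s * p) = degree s * p := by group
    rw [e1, e2, e3]; tauto

end ExelSemigroup

variable {A : Type u} [NonUnitalCStarAlgebra A] {G : Type v} [Group G]

/-- The action `β` of `S(G)` corresponds to the partial action `α` of `G`: `E_{[g]} = D_g` and
`β_{[g]} = α_g` for every `g`. -/
structure Corresponds (P : PartialAction G A) (Q : InvAction (ExelSemigroup G) A) : Prop where
  E_gen : ∀ g : G, Q.E (ExelSemigroup.gen g) = P.D g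
  β_gen : ∀ (g : G) (x : P.D g⁻¹) (y : Q.E (ExelSemigroup.gen g)⁻¹), (y : A) = x →
    (Q.β (ExelSemigroup.gen g) y : A) = P.α g x

theorem Corresponds.mem {P : PartialAction G A} {Q : InvAction (ExelSemigroup G) A}
    (h : Corresponds P Q) (g : G) {a : A} (ha : a ∈ P.D g) : a ∈ Q.E (ExelSemigroup.gen g) := by
  rw [h.E_gen]; exact ha

namespace PartialAction

open ExelSemigroup

variable (P : PartialAction G A)

/-- The ideal `⋂_{p ∈ X} D_p`. -/
def interIdeal (X : Set G) : ClosedIdeal A where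
  toSubmodule := ⨅ p ∈ X, (P.D p).toSubmodule
  mul_mem_left' a x hx := by
    simp only [Submodule.carrier_eq_coe, SetLike.mem_coe, Submodule.mem_iInf] at hx ⊢
    exact fun p hp => (P.D p).mul_mem_left a (hx p hp)
  mul_mem_right' a hx := by
    simp only [Submodule.carrier_eq_coe, SetLike.mem_coe, Submodule.mem_iInf] at hx ⊢
    exact fun p hp => (P.D p).mul_mem_right a (hx p hp)
  isClosed' := by
    simp only [Submodule.carrier_eq_coe, Submodule.coe_iInf]
    exact isClosed_biInter fun p _ => (P.D p).isClosed

theorem mem_interIdeal {X : Set G} {a : A} : a ∈ P.interIdeal X ↔ ∀ p ∈ X, a ∈ P.D p := by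
  change a ∈ ⨅ p ∈ X, (P.D p).toSubmodule ↔ _
  simp only [Submodule.mem_iInf]
  rfl

theorem symm_mem {g p : G} (y : P.D g) (hy : (y : A) ∈ P.D (g * p)) :
    ((P.α g).symm y : A) ∈ P.D p := by
  rw [← P.α_inv g ⟨y, P.mem_congr (inv_inv g).symm y.2⟩ y rfl]
  exact P.mem_congr (by simp) (P.α_mem (h := g * p) _ hy)

/-- The ideal `E_s = D_{r₁} ∩ D_{r₁r₂} ∩ ⋯ ∩ D_{r₁⋯rₙ}` for `s = [r₁]⋯[rₙ]`. -/
def exelIdeal (s : ExelSemigroup G) : ClosedIdeal A := P.interIdeal (supp s)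

theorem mem_exelIdeal {s : ExelSemigroup G} {a : A} :
    a ∈ P.exelIdeal s ↔ ∀ p ∈ supp s, a ∈ P.D p := P.mem_interIdeal

theorem mem_D_of_mem {s : ExelSemigroup G} {a : A} (h : a ∈ P.exelIdeal s) : a ∈ P.D (degree s) :=
  P.mem_exelIdeal.1 h _ (degree_mem_supp s)

theorem mem_D_of_mem_inv {s : ExelSemigroup G} {a : A} (h : a ∈ P.exelIdeal s⁻¹) :
    a ∈ P.D (degree s)⁻¹ := P.mem_congr (degree_inv s) (P.mem_D_of_mem h)

/-- The isomorphism `β_s`, the restriction of `α_{γ(s)}` to `E_{s*}`. -/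
noncomputable def exelMap (s : ExelSemigroup G) : P.exelIdeal s⁻¹ ≃⋆ₐ[ℂ] P.exelIdeal s where
  toFun x := ⟨P.α (degree s) ⟨x, P.mem_D_of_mem_inv x.2⟩, P.mem_exelIdeal.2 fun p hp => by
    have h := P.mem_exelIdeal.1 x.2 ((degree s)⁻¹ * p)
      ((mem_supp_inv _ _).2 (by rwa [mul_inv_cancel_left]))
    exact P.mem_congr (by simp) (P.α_mem ⟨x, P.mem_D_of_mem_inv x.2⟩ h)⟩
  invFun y := ⟨(P.α (degree s)).symm ⟨y, P.mem_D_of_mem y.2⟩, P.mem_exelIdeal.2 fun p hp =>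
    P.symm_mem _ (P.mem_exelIdeal.1 y.2 _ ((mem_supp_inv _ _).1 hp))⟩
  left_inv x := by ext; simp
  right_inv y := by ext; simp
  map_mul' x y := by
    have := congrArg Subtype.val (map_mul (P.α (degree s)) ⟨x, P.mem_D_of_mem_inv x.2⟩
      ⟨y, P.mem_D_of_mem_inv y.2⟩)
    exact Subtype.ext this
  map_add' x y := by
    have := congrArg Subtype.val (map_add (P.α (degree s)) ⟨x, P.mem_D_of_mem_inv x.2⟩
      ⟨y, P.mem_D_of_mem_inv y.2⟩)
    exact Subtype.ext this
  map_star' x := by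
    have := congrArg Subtype.val (map_star (P.α (degree s)) ⟨x, P.mem_D_of_mem_inv x.2⟩)
    exact Subtype.ext this
  map_smul' c x := by
    have := congrArg Subtype.val (map_smul (P.α (degree s)) c ⟨x, P.mem_D_of_mem_inv x.2⟩)
    exact Subtype.ext this

theorem exelMap_apply (s : ExelSemigroup G) (x : P.exelIdeal s⁻¹) (y : P.D (degree s)⁻¹)
    (h : (x : A) = y) : (P.exelMap s x : A) = P.α (degree s) y :=
  P.α_congr rfl _ _ h

/-- The action of `S(G)` corresponding to a partial action of `G`. -/
noncomputable def exelAction : InvAction (ExelSemigroup G) A where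
  E := P.exelIdeal
  β := P.exelMap
  E_one a := P.mem_exelIdeal.2 fun p hp => by
    rw [one_def, mem_supp_gen, or_self] at hp
    rw [hp]; exact P.D_one a
  mem_comp r s x := by
    rw [mul_inv_rev']
    constructor
    · intro hx
      rw [mem_exelIdeal] at hx
      have h1 : x ∈ P.exelIdeal s⁻¹ :=
        P.mem_exelIdeal.2 fun p hp => hx p ((mem_supp_mul _ _ _).2 (Or.inl hp))
      refine ⟨h1, P.mem_exelIdeal.2 fun q hq => ?_⟩
      have h2 := hx ((degree s)⁻¹ * q) ((mem_supp_mul _ _ _).2 (Or.inr (by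
        rw [degree_inv, inv_inv, mul_inv_cancel_left]; exact hq)))
      exact P.mem_congr (by simp) (P.α_mem ⟨x, P.mem_D_of_mem_inv h1⟩ h2)
    · rintro ⟨h1, h2⟩
      refine P.mem_exelIdeal.2 fun p hp => ?_
      rcases (mem_supp_mul _ _ _).1 hp with hp | hp
      · exact P.mem_exelIdeal.1 h1 p hp
      · rw [degree_inv, inv_inv] at hp
        have := P.symm_mem _ (P.mem_exelIdeal.1 h2 _ hp :
          (P.α (degree s) ⟨x, P.mem_D_of_mem_inv h1⟩ : A) ∈ _)
        rwa [StarAlgEquiv.symm_apply_apply] at this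
  comp r s x y z hyx hzx := by
    have e : (degree (r * s)) = degree r * degree s := map_mul _ _ _
    have h := P.comp (degree r) (degree s) ⟨x, P.mem_D_of_mem_inv x.2⟩
      ⟨y, P.mem_congr (by rw [e]) (P.mem_D_of_mem_inv y.2)⟩ ⟨z, P.mem_D_of_mem_inv z.2⟩ hyx hzx
    exact h.trans (P.α_congr e.symm _ _ rfl)

theorem corresponds_exelAction : Corresponds P P.exelAction where
  E_gen g := by
    refine SetLike.ext fun a => ?_
    change a ∈ P.exelIdeal (gen g) ↔ _
    rw [mem_exelIdeal]
    refine ⟨fun h => h g (mem_supp_gen.2 (Or.inr rfl)), fun h p hp => ?_⟩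
    rcases mem_supp_gen.1 hp with rfl | rfl
    · exact P.D_one a
    · exact h
  β_gen g x y h := P.α_congr (degree_gen g) _ _ h

variable {P}

/-- At most one action of `S(G)` corresponds to a given partial action of `G`. -/
theorem corresponds_unique {Q Q' : InvAction (ExelSemigroup G) A} (h : Corresponds P Q)
    (h' : Corresponds P Q') : Q = Q' := by
  have key : ∀ s : ExelSemigroup G, (∀ x : A, x ∈ Q.E s⁻¹ ↔ x ∈ Q'.E s⁻¹) ∧
      ∀ (x : Q.E s⁻¹) (y : Q'.E s⁻¹), (x : A) = y → (Q.β s x : A) = Q'.β s y := by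
    intro s
    have hg : ∀ g : G, Q.E (gen g)⁻¹ = P.D g⁻¹ := fun g => by rw [gen_inv, h.E_gen]
    have hg' : ∀ g : G, Q'.E (gen g)⁻¹ = P.D g⁻¹ := fun g => by rw [gen_inv, h'.E_gen]
    induction s using ExelSemigroup.induction with
    | h0 g =>
      refine ⟨fun x => by rw [hg, hg'], fun x y e => ?_⟩
      have hx : (x : A) ∈ P.D g⁻¹ := hg g ▸ x.2
      rw [h.β_gen g ⟨x, hx⟩ x rfl, h'.β_gen g ⟨x, hx⟩ y e.symm]
    | h1 g s ih =>
      refine ⟨fun x => ?_, fun x y e => ?_⟩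
      · rw [Q.mem_comp, Q'.mem_comp, hg, hg']
        constructor
        · rintro ⟨h1, h2⟩
          exact ⟨(ih.1 x).1 h1, by rwa [← ih.2 ⟨x, h1⟩ _ rfl]⟩
        · rintro ⟨h1, h2⟩
          exact ⟨(ih.1 x).2 h1, by rwa [ih.2 _ ⟨x, h1⟩ rfl]⟩
      · obtain ⟨h1, h2⟩ := (Q.mem_comp _ _ _).1 x.2
        obtain ⟨h1', h2'⟩ := (Q'.mem_comp _ _ _).1 y.2
        rw [← Q.comp _ _ ⟨x, h1⟩ x ⟨_, h2⟩ rfl rfl, ← Q'.comp _ _ ⟨y, h1'⟩ y ⟨_, h2'⟩ rfl rfl]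
        have h3 : (Q.β s ⟨x, h1⟩ : A) ∈ P.D g⁻¹ := hg g ▸ h2
        rw [h.β_gen g ⟨_, h3⟩ _ rfl, h'.β_gen g ⟨_, h3⟩ _ (ih.2 _ _ e).symm]
  have hE : Q.E = Q'.E := by
    funext s
    refine SetLike.ext fun x => ?_
    have := (key s⁻¹).1 x
    rwa [inv_inv] at this
  obtain ⟨E, β, _, _, _⟩ := Q
  obtain ⟨E', β', _, _, _⟩ := Q'
  obtain rfl : E = E' := hE
  obtain rfl : β = β' := by
    funext s
    refine StarAlgEquiv.ext fun x => Subtype.ext ((key s).2 x x rfl)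
  rfl

/-- Exactly one action of `S(G)` corresponds to a given partial action of `G`. -/
theorem existsUnique_corresponds (P : PartialAction G A) :
    ∃! Q : InvAction (ExelSemigroup G) A, Corresponds P Q :=
  ⟨P.exelAction, P.corresponds_exelAction, fun _ h => corresponds_unique h P.corresponds_exelAction⟩

end PartialAction

end Correspondence

end PCP

/-!
The isomorphism already exists between the algebraic crossed products, and the enveloping
C*-algebra is a functor of the *-algebra, so it carries isomorphisms to isomorphisms.

Since exactly one action of `S(G)` corresponds to `α`, one may take `β` to be `α.exelAction`, where
`E_s ⊆ D_{γ(s)}` and `β_s` is the restriction of `α_{γ(s)}`, with `γ : S(G) → G` the degree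
homomorphism. Hence `a δ_s ↦ a δ_{γ(s)}` is a *-homomorphism from `L` onto the algebraic crossed
product of `α` (`PartialAction.degreeAlgHom`). Related elements `r ≤ t` have the same degree, so it
kills `N` and descends to `L / N`. Its inverse is induced by `a δ_g ↦ a δ_{[g]}`: the standard form
of elements of `S(G)` gives `s ≤ [γ(s)]` (`ExelSemigroup.natLE_gen_degree`), so that `a δ_s` and
`a δ_{[γ(s)]}` have the same class in `L / N`. Only linearity of this inverse is needed; its
multiplicativity follows from that of the map it inverts.
-/

namespace PCP

universe u v w

/-! ### Functoriality of the enveloping C*-algebra -/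

section Functoriality

variable {B C : Type w} [NonUnitalRing B] [StarRing B] [Module ℂ B]
  [NonUnitalRing C] [StarRing C] [Module ℂ C]

/-- The pullback of a representation along a *-homomorphism. -/
noncomputable def Rep.comap (f : B →⋆ₙₐ[ℂ] C) (ρ : Rep C) : Rep B where
  H := ρ.H
  π := ρ.π.comp f

theorem envSeminorm_map_le [BoundedReps B] (f : B →⋆ₙₐ[ℂ] C) (x : B) :
    envSeminorm (f x) ≤ envSeminorm x :=
  ciSup_le fun ρ => le_envSeminorm (ρ.comap f) x

namespace Enveloping

open UniformSpace

variable [BoundedReps B] [BoundedReps C]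

/-- The extension of a *-homomorphism to the enveloping C*-algebras, as a function. -/
noncomputable def mapFun (f : B →⋆ₙₐ[ℂ] C) : Enveloping B → Enveloping C :=
  Completion.map (α := EnvPre B) (β := EnvPre C) f

theorem continuous_mapFun (f : B →⋆ₙₐ[ℂ] C) : Continuous (mapFun f) :=
  Completion.continuous_map

theorem mapFun_ofLin (f : B →⋆ₙₐ[ℂ] C) (x : B) : mapFun f (ofLin B x) = ofLin C (f x) := by
  let f' : EnvPre B →+ EnvPre C := (f : B →+ C)
  exact Completion.map_coe (α := EnvPre B) (β := EnvPre C) (f := f')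
    (AddMonoidHomClass.uniformContinuous_of_bound f' 1 fun x =>
      (envSeminorm_map_le f x).trans (one_mul _).ge) x

/-- The *-homomorphism of enveloping C*-algebras induced by a *-homomorphism. -/
noncomputable def map (f : B →⋆ₙₐ[ℂ] C) : Enveloping B →⋆ₙₐ[ℂ] Enveloping C where
  toFun := mapFun f
  map_smul' c := induction₁ (isClosed_eq ((continuous_mapFun f).comp (continuous_smul' B c))
    ((continuous_smul' C c).comp (continuous_mapFun f))) fun x => by
      simp only [← map_smul, mapFun_ofLin, MonoidHom.id_apply]
  map_zero' := by rw [← map_zero (ofLin B), mapFun_ofLin, map_zero, map_zero]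
  map_add' := induction₂ (isClosed_eq ((continuous_mapFun f).comp continuous_add)
    (((continuous_mapFun f).comp continuous_fst).add
      ((continuous_mapFun f).comp continuous_snd))) fun x y => by
      simp only [← map_add, mapFun_ofLin]
  map_mul' := induction₂ (isClosed_eq ((continuous_mapFun f).comp continuous_mul)
    (((continuous_mapFun f).comp continuous_fst).mul
      ((continuous_mapFun f).comp continuous_snd))) fun x y => by
      simp only [← ofLin_mul, mapFun_ofLin, map_mul]
  map_star' := induction₁ (isClosed_eq ((continuous_mapFun f).comp (continuous_star' B))
    ((continuous_star' C).comp (continuous_mapFun f))) fun x => by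
      simp only [← ofLin_star, mapFun_ofLin, map_star]

theorem map_of (f : B →⋆ₙₐ[ℂ] C) (x : B) : map f (of B x) = of C (f x) :=
  mapFun_ofLin f x

theorem leftInverse_map {f : B →⋆ₙₐ[ℂ] C} {g : C →⋆ₙₐ[ℂ] B}
    (h : Function.LeftInverse g f) : Function.LeftInverse (map g) (map f) :=
  induction₁ (isClosed_eq ((continuous_mapFun g).comp (continuous_mapFun f)) continuous_id)
    fun x => by
      change map g (map f (of B x)) = of B x
      rw [map_of, map_of, h x]

/-- Isomorphic *-algebras have isomorphic enveloping C*-algebras. -/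
noncomputable def congr (e : B ≃⋆ₐ[ℂ] C) : Enveloping B ≃⋆ₐ[ℂ] Enveloping C where
  __ := map (e : B →⋆ₙₐ[ℂ] C)
  invFun := map (e.symm : C →⋆ₙₐ[ℂ] B)
  left_inv := leftInverse_map e.symm_apply_apply
  right_inv := leftInverse_map e.apply_symm_apply

theorem congr_of (e : B ≃⋆ₐ[ℂ] C) (x : B) : congr e (of B x) = of C (e x) :=
  map_of (e : B →⋆ₙₐ[ℂ] C) x

end Enveloping

end Functoriality

/-! ### The natural order and the degree -/

namespace ExelSemigroup

variable {G : Type v} [Group G]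

/-- Every element of `S(G)` lies below the generator of the same degree. -/
theorem natLE_gen_degree (s : ExelSemigroup G) : InverseMonoid.NatLE s (gen (degree s)) := by
  -- The standard form has its idempotent on the left, so it is applied to `s⁻¹` and inverted.
  obtain ⟨x, hx, hs⟩ := exists_standard_form s⁻¹
  refine ⟨x, (epsProd_idem hx).1, ?_⟩
  have h := congrArg (·⁻¹) hs
  simpa only [inv_inv', mul_inv_rev', gen_inv, degree_inv, inv_inv, (epsProd_idem hx).2] using h

theorem degree_eq_of_natLE {r t : ExelSemigroup G} (h : InverseMonoid.NatLE r t) :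
    degree r = degree t := by
  obtain ⟨f, hf, rfl⟩ := h
  have hd : degree f = 1 := by
    have := congrArg degree hf
    rwa [map_mul, mul_eq_left] at this
  rw [map_mul, hd, mul_one]

end ExelSemigroup

/-! ### The isomorphism of the algebraic crossed products -/

namespace PartialAction

open ExelSemigroup

variable {A : Type u} [NonUnitalCStarAlgebra A] {G : Type v} [Group G] (P : PartialAction G A)

/-- The linear map `a δ_s ↦ a δ_{γ(s)}` from `L` to the algebraic crossed product of the partial
action. -/
noncomputable def degreeLin : P.exelAction.L →ₗ[ℂ] P.AlgCrossedProduct :=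
  P.exelAction.toSystem.linearLift fun s => P.toSystem.single (degree s) ∘ₗ
    { toFun := fun a => ⟨a, P.mem_D_of_mem a.2⟩
      map_add' := fun _ _ => rfl
      map_smul' := fun _ _ => rfl }

theorem degreeLin_single (s : ExelSemigroup G) (a : P.exelAction.toSystem.D s) :
    P.degreeLin (P.exelAction.toSystem.single s a) =
      P.toSystem.single (degree s) ⟨a, P.mem_D_of_mem a.2⟩ :=
  P.exelAction.toSystem.linearLift_single _ _ _

theorem degreeLin_mul (x y : P.exelAction.L) :
    P.degreeLin (x * y) = P.degreeLin x * P.degreeLin y := by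
  induction x using System.alg_induction with
  | h0 => simp
  | h2 x x' h h' => simp only [add_mul, map_add, h, h']
  | h1 r a =>
  induction y using System.alg_induction with
  | h0 => simp
  | h2 y y' h h' => simp only [mul_add, map_add, h, h']
  | h1 s b =>
  rw [System.single_mul_single, degreeLin_single, degreeLin_single, degreeLin_single,
    System.single_mul_single]
  exact P.toSystem.single_congr (map_mul degree r s) _ _ rfl

theorem degreeLin_star (x : P.exelAction.L) : P.degreeLin (star x) = star (P.degreeLin x) := by
  induction x using System.alg_induction with
  | h0 => simp
  | h2 x x' h h' => simp only [star_add, map_add, h, h']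
  | h1 s a =>
  rw [System.star_single, degreeLin_single, degreeLin_single, System.star_single]
  exact P.toSystem.single_congr (degree_inv s) _ _ rfl

/-- The ideal `N` is contained in the kernel of `a δ_s ↦ a δ_{γ(s)}`. -/
theorem N_le_ker_degreeLin : P.exelAction.N.toSubmodule ≤ LinearMap.ker P.degreeLin := by
  refine idealSpan_le ?_ fun b x hx => ?_
  · rintro _ ⟨r, t, h, a, rfl⟩
    rw [SetLike.mem_coe, LinearMap.mem_ker, map_sub, sub_eq_zero]
    refine (P.degreeLin_single r a).trans (Eq.trans ?_ (P.degreeLin_single t _).symm)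
    exact P.toSystem.single_congr (degree_eq_of_natLE h) _ _ rfl
  · rw [LinearMap.mem_ker] at hx
    simp only [LinearMap.mem_ker, degreeLin_mul, hx, mul_zero, zero_mul, and_self]

/-- The *-homomorphism `L / N → A ⋊ᵃ G` with `a δ_s ↦ a δ_{γ(s)}`. -/
noncomputable def degreeAlgHom : P.exelAction.AlgCrossedProduct →⋆ₙₐ[ℂ] P.AlgCrossedProduct :=
  let F : P.exelAction.AlgCrossedProduct →ₗ[ℂ] P.AlgCrossedProduct :=
    P.exelAction.N.toSubmodule.liftQ P.degreeLin P.N_le_ker_degreeLin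
  have hF : ∀ x, F (P.exelAction.N.proj x) = P.degreeLin x := fun x =>
    P.exelAction.N.toSubmodule.liftQ_apply P.degreeLin x
  { toFun := F
    map_smul' := map_smul F
    map_zero' := map_zero F
    map_add' := map_add F
    map_mul' := fun x y => by
      obtain ⟨x, rfl⟩ := P.exelAction.N.proj_surjective x
      obtain ⟨y, rfl⟩ := P.exelAction.N.proj_surjective y
      rw [← map_mul, hF, hF, hF, degreeLin_mul]
    map_star' := fun x => by
      obtain ⟨x, rfl⟩ := P.exelAction.N.proj_surjective x
      rw [← map_star, hF, hF, degreeLin_star] }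

theorem degreeAlgHom_proj (x : P.exelAction.L) :
    P.degreeAlgHom (P.exelAction.N.proj x) = P.degreeLin x :=
  P.exelAction.N.toSubmodule.liftQ_apply P.degreeLin (h := P.N_le_ker_degreeLin) x

theorem mem_exelIdeal_gen {g : G} {a : A} (ha : a ∈ P.D g) : a ∈ P.exelIdeal (gen g) :=
  P.corresponds_exelAction.mem g ha

/-- The linear map `A ⋊ᵃ G → L / N` with `a δ_g ↦ a δ_{[g]}`. -/
noncomputable def genLin : P.AlgCrossedProduct →ₗ[ℂ] P.exelAction.AlgCrossedProduct :=
  P.toSystem.linearLift fun g =>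
    (P.exelAction.N.mkLin ∘ₗ P.exelAction.toSystem.single (gen g)) ∘ₗ
    { toFun := fun a => ⟨a, P.mem_exelIdeal_gen a.2⟩
      map_add' := fun _ _ => rfl
      map_smul' := fun _ _ => rfl }

theorem genLin_single (g : G) (a : P.D g) :
    P.genLin (P.toSystem.single g a) =
      P.exelAction.N.proj (P.exelAction.δ (gen g) ⟨a, P.mem_exelIdeal_gen a.2⟩) :=
  P.toSystem.linearLift_single _ _ _

theorem degreeAlgHom_genLin (x : P.AlgCrossedProduct) : P.degreeAlgHom (P.genLin x) = x := by
  induction x using System.alg_induction with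
  | h0 => simp
  | h2 x x' h h' => simp only [map_add, h, h']
  | h1 g a =>
  rw [genLin_single, degreeAlgHom_proj]
  refine (P.degreeLin_single _ _).trans ?_
  exact P.toSystem.single_congr (degree_gen g) _ _ rfl

theorem genLin_degreeAlgHom (x : P.exelAction.AlgCrossedProduct) :
    P.genLin (P.degreeAlgHom x) = x := by
  obtain ⟨x, rfl⟩ := P.exelAction.N.proj_surjective x
  induction x using System.alg_induction with
  | h0 => simp
  | h2 x x' h h' => simp only [map_add, h, h']
  | h1 s a =>
  rw [degreeAlgHom_proj, degreeLin_single, genLin_single]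
  exact (P.exelAction.proj_eq_of_le (natLE_gen_degree s) a).symm

/-- The *-isomorphism `L / N ≅ A ⋊ᵃ G` of the algebraic crossed products. -/
noncomputable def degreeAlgEquiv : P.exelAction.AlgCrossedProduct ≃⋆ₐ[ℂ] P.AlgCrossedProduct where
  __ := P.degreeAlgHom
  invFun := P.genLin
  left_inv := P.genLin_degreeAlgHom
  right_inv := P.degreeAlgHom_genLin

end PartialAction

end PCP

/-- Let `α` be a partial action of a group `G` on a C*-algebra `A` and let `β` be the action of
Exel's inverse semigroup `S(G)` on `A` corresponding to `α`. Then there is a *-isomorphism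
`A ⋊_α G ≅ A ⋊_β S(G)` sending the class of `a δ_g` to the class of `a δ_{[g]}`. -/
theorem theorem4p4 {G : Type*} [Group G] {A : Type*} [NonUnitalCStarAlgebra A]
    (α : PCP.PartialAction G A) (β : PCP.InvAction (PCP.ExelSemigroup G) A)
    (hβ : PCP.Corresponds α β) :
    ∃ φ : α.CrossedProduct ≃⋆ₐ[ℂ] β.CrossedProduct,
      ∀ (g : G) (a : α.D g),
        φ (α.ι (α.δ g a)) =
          β.ι (β.N.proj (β.δ (PCP.ExelSemigroup.gen g) ⟨a, hβ.mem g a.2⟩)) := by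
  obtain rfl := PCP.PartialAction.corresponds_unique hβ α.corresponds_exelAction
  refine ⟨PCP.Enveloping.congr α.degreeAlgEquiv.symm, fun g a => ?_⟩
  exact (PCP.Enveloping.congr_of _ _).trans
    (congrArg α.exelAction.ι (α.genLin_single g a))
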